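/- **Setting.** Fix $d$ and let $\mathbf y=(\mathbf y_1,\mathbf y_2,\dots)$ be distributed according to a probability measure $\mathbb P^{\mathbf Y}$ on a product $\prod_{i\ge 1}\mathsf Y_i$ of measurable spaces. For every $n\ge 1$ let $\pi_n=\pi_n(\cdot\,;\mathbf y)$ be a data-dependent probability density on $\mathbb R^d$, jointly measurable in its two arguments (for instance the posterior density given $\mathbf y_1,\dots,\mathbf y_n$), let $\hat\theta_n=\hat\theta_n(\mathbf y)\in\mathbb R^d$ be a measurable estimator, and let $M_n=M_n(\mathbf y)\in\mathbb R^{d\times d}$ be a measurable random matrix. Let $\theta\mapsto I(\theta)\in\mathbb R^{d\times d}$ be the Fisher information (any matrix-valued function is allowed), let $\theta_0\in\mathbb R^d$ with $I(\theta_0)$ symmetric positive definite, and let $\lambda>0$. Write $\varphi(\cdot\,;\mu,\Sigma)$ for the Gaussian distribution (and its density) with mean $\mu$ and covariance $\Sigma$, and $\|x\|_A^2=x^TAx$. Random integrals $I_n$ (functions of $\mathbf y$) are said to converge to a constant $I$ in $\mathbb P^{\mathbf Y}$-probability when $\mathbb E_{\mathbb P^{\mathbf Y}}|I_n-I|\to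 0$; random vectors and the entries of random matrices converge in probability in the usual sense; a random path law converges weakly in $\mathbb P^{\mathbf Y}$-probability when, for every $k$ and every bounded continuous $h$ on $(\mathbb R^d)^{k+1}$, the expectation of $h(\mathbf Z_0,\dots,\mathbf Z_k)$ converges in $\mathbb P^{\mathbf Y}$-probability. The random-walk Metropolis (RWM) algorithm with target density $f$ on $\mathbb R^d$ and scaling matrix $S$ moves from $x$ to the proposal $x'=x+S\varepsilon$, $\varepsilon\sim\varphi(\cdot\,;0,\mathbf 1)$, with probability $\min\{1,f(x')/f(x)\}$, and otherwise stays at $x$. Assume: 1. $\displaystyle\int_{\mathbb R^d}\left|\pi_n(\theta)-\varphi(\theta;\hat\theta_n,I(\theta_0)^{-1}/n)\right|d\theta\to 0$ and $\hat\theta_n\to\theta_0$ in $\mathbb P^{\mathbf Y}$-probability; 2. $S_n=(\lambda/\sqrt n)\,M_n$, and there is a matrix $M\in\mathbb R^{d\times d}$ such that $M_nM_n^T\to MM^T$ entrywise in $\mathbb P^{\mathbf Y}$-probability. Given the data, let $(\theta_{k,n})_{k\ge0}$ be the RWM chain with target $\pi_n$ and scaling matrix $S_n$, started with $\theta_{0,n}\sim\pi_n$,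 and let $\Xi_n=(\mathbf Z_{k,n})_{k\ge0}$, $\mathbf Z_{k,n}=\sqrt n\,(\theta_{k,n}-\hat\theta_n)$, be the standardized chain. Let $\pi_{\mathbf Z_n}(z)=\pi_n(\hat\theta_n+n^{-1/2}z)/n^{d/2}$. Let $\Xi=(\mathbf Z_k)_{k\ge0}$ be the RWM chain with target $\varphi(\cdot\,;0,I(\theta_0)^{-1})$ and scaling matrix $\lambda M$, started with $\mathbf Z_0\sim\varphi(\cdot\,;0,I(\theta_0)^{-1})$. **Theorem 1.** As $n\to\infty$, the following convergences hold in $\mathbb P^{\mathbf Y}$-probability: (i) $\Xi_n$ converges weakly to $\Xi$; (ii) the expected acceptance probability converges, $$\mathbb E\left[\min\left\{1,\frac{\pi_{\mathbf Z_n}(\mathbf Z_n')}{\pi_{\mathbf Z_n}(\mathbf Z_n)}\right\}\right]\to\mathbb E\left[\min\left\{1,\frac{\varphi(\mathbf Z';0,I(\theta_0)^{-1})}{\varphi(\mathbf Z;0,I(\theta_0)^{-1})}\right\}\right],$$ where $\mathbf Z_n\sim\pi_{\mathbf Z_n}$, $\mathbf Z_n'\sim\varphi(\cdot\,;\mathbf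 Z_n,\lambda^2M_nM_n^T)$, $\mathbf Z\sim\varphi(\cdot\,;0,I(\theta_0)^{-1})$, $\mathbf Z'\sim\varphi(\cdot\,;\mathbf Z,\lambda^2MM^T)$; (iii) if additionally, for every $n\ge1$, $M_nM_n^T=I(\hat\theta_n)^{-1}$ almost surely, and $MM^T=I(\theta_0)^{-1}$, then for every $k\ge 0$ the expected squared jumping distance is finite (almost surely, for every $n\ge1$, and in the limit) and converges, $$\mathbb E\left[\|\mathbf Z_{k+1,n}-\mathbf Z_{k,n}\|^2_{I(\hat\theta_n)}\right]\to\mathbb E\left[\|\mathbf Z_{k+1}-\mathbf Z_k\|^2_{I(\theta_0)}\right].$$ -/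

import Mathlib

open MeasureTheory ProbabilityTheory Filter Topology
open scoped ENNReal Matrix BoundedContinuousFunction

namespace RWM

/-- The parameter space `ℝ^d` with its Euclidean structure. -/
abbrev Vec (d : ℕ) : Type := EuclideanSpace ℝ (Fin d)

/-- Square matrices of size `d` with real entries. -/
abbrev Mat (d : ℕ) : Type := Matrix (Fin d) (Fin d) ℝ

/-- The squared norm `‖x‖²_A = xᵀ A x` of a vector with respect to a matrix. -/
def normSq {d : ℕ} (A : Mat d) (x : Vec d) : ℝ :=
  x.ofLp ⬝ᵥ (A *ᵥ x.ofLp)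

/-- The Lebesgue density `φ(x; μ, C)` of the Gaussian distribution with mean `μ` and (positive
definite) covariance matrix `C`. -/
noncomputable def gaussianDensity {d : ℕ} (μ : Vec d) (C : Mat d) (x : Vec d) : ℝ :=
  (Real.sqrt ((2 * Real.pi) ^ d * C.det))⁻¹ * Real.exp (-(normSq C⁻¹ (x - μ)) / 2)

/-- The measure on `ℝ^d` with Lebesgue density `f`. -/
noncomputable def densityMeasure {d : ℕ} (f : Vec d → ℝ) : Measure (Vec d) :=
  volume.withDensity (fun x => ENNReal.ofReal (f x))

/-- The Metropolis acceptance probability `min {1, f x' / f x}` for the target density `f`. -/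
noncomputable def accept {d : ℕ} (f : Vec d → ℝ) (x x' : Vec d) : ℝ :=
  min 1 (f x' / f x)

/-- The law of the proposal `x + S ε`, with `ε` standard normal on `ℝ^d`. -/
noncomputable def proposal {d : ℕ} (S : Mat d) (x : Vec d) : Measure (Vec d) :=
  (stdGaussian (Vec d)).map (fun ε => x + Matrix.toEuclideanCLM (𝕜 := ℝ) S ε)

/-- One transition of the random-walk Metropolis algorithm from the state `x`: a proposal `x'` is
accepted with probability `accept f x x'`; upon rejection the chain stays at `x`. -/
noncomputable def transition {d : ℕ} (f : Vec d → ℝ) (S : Mat d) (x : Vec d) : Measure (Vec d) :=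
  (proposal S x).withDensity (fun x' => ENNReal.ofReal (accept f x x'))
    + (1 - ∫⁻ x', ENNReal.ofReal (accept f x x') ∂(proposal S x)) • Measure.dirac x

theorem measurable_normSq {d : ℕ} (A : Mat d) : Measurable (normSq A) := by
  have : Continuous (normSq A) := by
    unfold normSq dotProduct Matrix.mulVec dotProduct
    fun_prop
  exact this.measurable

theorem measurable_gaussianDensity {d : ℕ} (μ : Vec d) (C : Mat d) :
    Measurable (gaussianDensity μ C) := by
  have h : Measurable (fun x : Vec d => normSq C⁻¹ (x - μ)) :=
    (measurable_normSq C⁻¹).comp (measurable_id.sub_const μ)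
  unfold gaussianDensity
  fun_prop

theorem measurable_accept {d : ℕ} {f : Vec d → ℝ} (hf : Measurable f) :
    Measurable (fun p : Vec d × Vec d => ENNReal.ofReal (accept f p.1 p.2)) := by
  unfold accept
  fun_prop

theorem measurable_proposal {d : ℕ} (S : Mat d) : Measurable (proposal S) := by
  refine Measure.measurable_of_measurable_coe _ fun s hs => ?_
  have h : Measurable (fun p : Vec d × Vec d =>
      p.1 + Matrix.toEuclideanCLM (𝕜 := ℝ) S p.2) := by fun_prop
  have h2 : (fun x => proposal S x s) = fun x => stdGaussian (Vec d) (Prod.mk x ⁻¹'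
      ((fun p : Vec d × Vec d => p.1 + Matrix.toEuclideanCLM (𝕜 := ℝ) S p.2) ⁻¹' s)) := by
    funext x
    rw [proposal, Measure.map_apply (by fun_prop) hs]
    rfl
  rw [h2]
  exact measurable_measure_prodMk_left (h hs)

instance isProbabilityMeasure_proposal {d : ℕ} (S : Mat d) (x : Vec d) :
    IsProbabilityMeasure (proposal S x) :=
  Measure.isProbabilityMeasure_map (by fun_prop)

/-- The proposal mechanism as a Markov kernel. -/
noncomputable def proposalKernel {d : ℕ} (S : Mat d) : Kernel (Vec d) (Vec d) :=
  ⟨proposal S, measurable_proposal S⟩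

instance isMarkovKernel_proposalKernel {d : ℕ} (S : Mat d) :
    IsMarkovKernel (proposalKernel S) :=
  ⟨fun x => isProbabilityMeasure_proposal S x⟩

theorem measurable_transition {d : ℕ} {f : Vec d → ℝ} (hf : Measurable f) (S : Mat d) :
    Measurable (transition f S) := by
  have hacc := measurable_accept hf
  have hreject : Measurable (fun x : Vec d =>
      ∫⁻ x', ENNReal.ofReal (accept f x x') ∂(proposal S x)) :=
    Measurable.lintegral_kernel_prod_right (κ := proposalKernel S) hacc
  refine Measure.measurable_of_measurable_coe _ fun s hs => ?_
  have h1 : Measurable (fun x : Vec d =>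
      ∫⁻ x' in s, ENNReal.ofReal (accept f x x') ∂(proposal S x)) :=
    Measurable.setLIntegral_kernel_prod_right (κ := proposalKernel S)
      (f := fun x x' => ENNReal.ofReal (accept f x x')) hacc hs
  have h2 : (fun x => transition f S x s) = fun x =>
      (∫⁻ x' in s, ENNReal.ofReal (accept f x x') ∂(proposal S x))
        + (1 - ∫⁻ x', ENNReal.ofReal (accept f x x') ∂(proposal S x)) *
          s.indicator 1 x := by
    funext x
    simp [transition, withDensity_apply _ hs, Measure.dirac_apply' _ hs]
  rw [h2]
  exact h1.add ((measurable_const.sub hreject).mul (measurable_one.indicator hs))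

/-- The Markov kernel of the random-walk Metropolis algorithm that targets the density `f` with
scaling matrix `S`. -/
noncomputable def kernel {d : ℕ} (f : Vec d → ℝ) (hf : Measurable f) (S : Mat d) :
    Kernel (Vec d) (Vec d) :=
  ⟨transition f S, measurable_transition hf S⟩

instance isMarkovKernel_kernel {d : ℕ} (f : Vec d → ℝ) (hf : Measurable f) (S : Mat d) :
    IsMarkovKernel (kernel f hf S) := by
  refine ⟨fun x => ⟨?_⟩⟩
  have hle : ∫⁻ x', ENNReal.ofReal (accept f x x') ∂(proposal S x) ≤ 1 := by
    calc ∫⁻ x', ENNReal.ofReal (accept f x x') ∂(proposal S x)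
        ≤ ∫⁻ _, 1 ∂(proposal S x) := by
          refine lintegral_mono fun x' => ?_
          rw [← ENNReal.ofReal_one]
          exact ENNReal.ofReal_le_ofReal (min_le_left _ _)
      _ = 1 := by simp
  change transition f S x Set.univ = 1
  simp only [transition, Measure.add_apply, Measure.smul_apply, smul_eq_mul,
    withDensity_apply _ MeasurableSet.univ, Measure.restrict_univ, measure_univ, mul_one]
  exact add_tsub_cancel_of_le hle

/-- The law on path space of the random-walk Metropolis chain that targets the density `f` with
scaling matrix `S` and starts in stationarity: the initial state has density `f` and all
transitions follow the Markov kernel `kernel f hf S`. -/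
noncomputable def chainLaw {d : ℕ} (f : Vec d → ℝ) (hf : Measurable f) (S : Mat d) :
    Measure (ℕ → Vec d) :=
  Kernel.trajMeasure (X := fun _ => Vec d) (densityMeasure f)
    (fun k => (kernel f hf S).comap
      (fun path : (i : Finset.Iic k) → Vec d => path ⟨k, Finset.mem_Iic.2 le_rfl⟩)
      (measurable_pi_apply _))

/-- The law of the standardized chain `Z_k = √n (θ_k - c)`, where `(θ_k)` is the stationary
random-walk Metropolis chain with target density `f` and scaling matrix `S`. -/
noncomputable def standardizedChainLaw {d : ℕ} (n : ℕ) (c : Vec d)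
    (f : Vec d → ℝ) (hf : Measurable f) (S : Mat d) : Measure (ℕ → Vec d) :=
  (chainLaw f hf S).map (fun θ k => Real.sqrt n • (θ k - c))

/-- The density `z ↦ f (c + n^{-1/2} z) / n^{d/2}` of `√n (θ - c)` when `θ` has density `f`. -/
noncomputable def standardizedDensity {d : ℕ} (n : ℕ) (c : Vec d) (f : Vec d → ℝ) :
    Vec d → ℝ :=
  fun z => f (c + (Real.sqrt n)⁻¹ • z) / Real.sqrt n ^ d

/-- The expected acceptance probability `𝔼[min {1, f(Z') / f(Z)}]` when `Z` has density `f` and,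
given `Z`, the proposal `Z'` is Gaussian with mean `Z` and covariance matrix `C`. -/
noncomputable def expectedAcceptance {d : ℕ} (f : Vec d → ℝ) (C : Mat d) : ℝ :=
  ∫ z, ∫ z', accept f z z' ∂(multivariateGaussian z C) ∂(densityMeasure f)

/-- Convergence in `P`-probability of random integrals `I_n` to a constant `I`, in the sense
that the `P`-expectation of `|I_n - I|` tends to `0`. -/
def IntegralTendsto {Ω : Type*} [MeasurableSpace Ω] (P : Measure Ω) (I : ℕ → Ω → ℝ)
    (I₀ : ℝ) : Prop :=
  Tendsto (fun n => ∫⁻ y, ENNReal.ofReal |I n y - I₀| ∂P) atTop (𝓝 0)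

/-- Weak convergence, in `P`-probability, of random path laws `Q_n` towards `Q`: all
finite-dimensional distributions converge weakly in `P`-probability. -/
def WeaklyTendsto {Ω : Type*} [MeasurableSpace Ω] {d : ℕ} (P : Measure Ω)
    (Q : ℕ → Ω → Measure (ℕ → Vec d)) (Q₀ : Measure (ℕ → Vec d)) : Prop :=
  ∀ (k : ℕ) (h : (Fin (k + 1) → Vec d) →ᵇ ℝ),
    IntegralTendsto P (fun n y => ∫ z, h (fun i => z i) ∂(Q n y))
      (∫ z, h (fun i => z i) ∂Q₀)

end RWM

namespace RWM

/-! Standardizing an RWM chain by z = √n (θ - c) gives the RWM chain with target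
`standardizedDensity` and scaling √n S, because the Jacobian cancels in the acceptance ratio. With S
= (λ/√n) M_n the scaling becomes λ M_n, so the claim compares RWM with target f_n and scaling λ M_n
to RWM with target φ = N(0, C) and scaling λ M. The L¹-distance of f_n and φ is exactly the
Bernstein–von Mises distance, since L¹-distances survive the change of variables. The comparison has
two independent halves.

Change of target, scaling fixed. Stationarity weights the acceptance probability by the target, and
f(x) accept(x, x') = min(f(x), f(x')) (`mul_accept`) is Lipschitz in f. Translation invariance of
Lebesgue measure then bounds all errors by multiples of the L¹-distance, uniformly in the scaling
matrix: `enorm_integral_chainLaw_sub_le` for path laws, `enorm_meanAccept_toReal_sub_le` for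
acceptance and jumps. Only the expectation of the L¹-distance enters.

Change of scaling, Gaussian target. As φ is continuous and positive, dominated convergence gives
continuity in S. Only M_n M_nᵀ converges, not M_n; but the relevant quantities depend on S through S
Sᵀ alone, and S ↦ S Sᵀ is proper, so continuity descends (`tendsto_comap_mul_transpose`).
Boundedness turns convergence in probability into convergence of expectations
(`integralTendsto_comp`).

For the jumping distance, M_n M_nᵀ = I(θ̂_n)⁻¹ makes the squared length of an accepted move λ²‖ε‖²,
free of n and of the data. This weight is unbounded but integrable, and both halves tolerate such a
weight. -/

variable {d : ℕ}

/-! ### Gaussian proposals and their symmetry -/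

/-- Both sides have the same characteristic function. Hence the proposal, and later the whole chain,
depends on S only through S Sᵀ. -/
theorem proposal_eq_multivariateGaussian (S : Mat d) (x : Vec d) :
    proposal S x = multivariateGaussian x (S * Sᵀ) := by
  have hS : (S * Sᵀ).PosSemidef := by
    simpa using Matrix.posSemidef_self_mul_conjTranspose S
  refine Measure.ext_of_charFun ?_
  ext t
  have h : proposal S x = ((stdGaussian (Vec d)).map
      (Matrix.toEuclideanCLM (𝕜 := ℝ) S)).map (fun v => x + v) := by
    rw [Measure.map_map (by fun_prop) (by fun_prop)]; rfl
  have h2 : charFun ((stdGaussian (Vec d)).map (Matrix.toEuclideanCLM (𝕜 := ℝ) S)) t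
      = charFun (stdGaussian (Vec d)) (Matrix.toEuclideanCLM (𝕜 := ℝ) Sᵀ t) := by
    rw [charFun_apply, charFun_apply, integral_map (by fun_prop) (by fun_prop)]
    congr 1 with v
    congr 3
    have : Sᵀ = star S := by simp [Matrix.star_eq_conjTranspose]
    rw [this, map_star, ContinuousLinearMap.star_eq_adjoint,
      ContinuousLinearMap.adjoint_inner_right]
  have h3 : ‖Matrix.toEuclideanCLM (𝕜 := ℝ) Sᵀ t‖ ^ 2 = t.ofLp ⬝ᵥ (S * Sᵀ) *ᵥ t.ofLp := by
    rw [← real_inner_self_eq_norm_sq, Matrix.inner_toEuclideanCLM,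
      Matrix.ofLp_toEuclideanCLM, ← Matrix.mulVec_mulVec, Matrix.dotProduct_mulVec _ S,
      ← Matrix.mulVec_transpose]
  rw [h, charFun_map_const_add, charFun_multivariateGaussian hS, h2, charFun_stdGaussian, ← h3,
    ← Complex.exp_add]
  congr 1
  push_cast
  rw [real_inner_comm]
  ring

theorem proposal_congr {S T : Mat d} (h : S * Sᵀ = T * Tᵀ) : proposal S = proposal T := by
  funext x
  rw [proposal_eq_multivariateGaussian, proposal_eq_multivariateGaussian, h]

theorem lintegral_proposal (S : Mat d) (x : Vec d) {g : Vec d → ℝ≥0∞} (hg : Measurable g) :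
    ∫⁻ x', g x' ∂(proposal S x)
      = ∫⁻ ε, g (x + Matrix.toEuclideanCLM (𝕜 := ℝ) S ε) ∂(stdGaussian (Vec d)) := by
  rw [proposal, lintegral_map hg (by fun_prop)]

/-- Tonelli and translation invariance in x for each fixed ε. The result does not involve S, which
is what makes the later error bounds uniform in the scaling matrix. -/
theorem lintegral_lintegral_shift_mul (S : Mat d) {h w : Vec d → ℝ≥0∞} (hh : Measurable h)
    (hw : Measurable w) :
    ∫⁻ x, ∫⁻ ε, h (x + Matrix.toEuclideanCLM (𝕜 := ℝ) S ε) * w ε ∂(stdGaussian (Vec d))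
      = (∫⁻ x, h x) * ∫⁻ ε, w ε ∂(stdGaussian (Vec d)) := by
  rw [lintegral_lintegral_swap (by fun_prop)]
  have : ∀ ε : Vec d, ∫⁻ x, h (x + Matrix.toEuclideanCLM (𝕜 := ℝ) S ε) * w ε
      = (∫⁻ x, h x) * w ε := fun ε => by
    rw [lintegral_mul_const _ (by fun_prop), lintegral_add_right_eq_self]
  simp_rw [this]
  rw [lintegral_const_mul _ hw]

instance isNegInvariant_stdGaussian : (stdGaussian (Vec d)).IsNegInvariant :=
  ⟨stdGaussian_map (LinearIsometryEquiv.neg ℝ (E := Vec d))⟩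

/-- Symmetry of the random-walk proposal: replace ε by -ε, then translate x by Sε. -/
theorem lintegral_lintegral_shift_swap (S : Mat d) {G : Vec d → Vec d → ℝ≥0∞}
    (hG : Measurable (Function.uncurry G)) :
    ∫⁻ x, ∫⁻ ε, G x (x + Matrix.toEuclideanCLM (𝕜 := ℝ) S ε) ∂(stdGaussian (Vec d))
      = ∫⁻ x, ∫⁻ ε, G (x + Matrix.toEuclideanCLM (𝕜 := ℝ) S ε) x ∂(stdGaussian (Vec d)) := by
  have m1 : Measurable (Function.uncurry fun (x ε : Vec d) =>
      G x (x + Matrix.toEuclideanCLM (𝕜 := ℝ) S ε)) :=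
    hG.comp (f := fun p : Vec d × Vec d => (p.1, p.1 + Matrix.toEuclideanCLM (𝕜 := ℝ) S p.2))
      (by fun_prop)
  have m2 : Measurable (Function.uncurry fun (x ε : Vec d) =>
      G (x + Matrix.toEuclideanCLM (𝕜 := ℝ) S ε) x) :=
    hG.comp (f := fun p : Vec d × Vec d => (p.1 + Matrix.toEuclideanCLM (𝕜 := ℝ) S p.2, p.1))
      (by fun_prop)
  rw [lintegral_lintegral_swap m1.aemeasurable, lintegral_lintegral_swap m2.aemeasurable,
    ← lintegral_neg_eq_self]
  refine lintegral_congr fun ε => ?_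
  rw [← lintegral_add_right_eq_self (fun x => G x _) (Matrix.toEuclideanCLM (𝕜 := ℝ) S ε)]
  simp

/-- The ratio f(x')/f(x) is unstable where f is small; multiplied by f(x) it becomes a minimum,
symmetric in the two states and Lipschitz in f. Where f(x) = 0 both sides vanish. -/
theorem mul_accept {f : Vec d → ℝ} (hf : ∀ x, 0 ≤ f x) (x x' : Vec d) :
    f x * accept f x x' = min (f x) (f x') := by
  rcases (hf x).eq_or_lt with h | h
  · rw [← h, zero_mul, min_eq_left (hf x')]
  · rw [accept, mul_min_of_nonneg _ _ h.le, mul_one, mul_div_cancel₀ _ h.ne']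

theorem accept_nonneg {f : Vec d → ℝ} (hf : ∀ x, 0 ≤ f x) (x x' : Vec d) : 0 ≤ accept f x x' :=
  le_min zero_le_one (div_nonneg (hf x') (hf x))

theorem accept_le_one (f : Vec d → ℝ) (x x' : Vec d) : accept f x x' ≤ 1 := min_le_left _ _

theorem measurable_accept_real {f : Vec d → ℝ} (hf : Measurable f) :
    Measurable (fun p : Vec d × Vec d => accept f p.1 p.2) := by
  unfold accept
  fun_prop

/-! ### Gaussian densities -/

theorem normSq_transpose_mul_self (B : Mat d) (x : Vec d) :
    normSq (Bᵀ * B) x = ‖Matrix.toEuclideanCLM (𝕜 := ℝ) B x‖ ^ 2 := by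
  rw [← real_inner_self_eq_norm_sq, Matrix.inner_toEuclideanCLM,
      Matrix.ofLp_toEuclideanCLM, normSq, ← Matrix.mulVec_mulVec, Matrix.dotProduct_mulVec,
      Matrix.vecMul_transpose]

theorem gaussianDensity_nonneg (μ : Vec d) (C : Mat d) (x : Vec d) : 0 ≤ gaussianDensity μ C x := by
  unfold gaussianDensity
  positivity

theorem gaussianDensity_pos (μ : Vec d) {C : Mat d} (hC : C.PosDef) (x : Vec d) :
    0 < gaussianDensity μ C x := by
  unfold gaussianDensity
  have := hC.det_pos
  positivity

theorem continuous_normSq (A : Mat d) : Continuous (normSq A) := by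
  unfold normSq dotProduct Matrix.mulVec dotProduct
  fun_prop

theorem continuous_gaussianDensity (μ : Vec d) (C : Mat d) : Continuous (gaussianDensity μ C) := by
  have h : Continuous (fun x : Vec d => normSq C⁻¹ (x - μ)) :=
    (continuous_normSq C⁻¹).comp (continuous_id.sub continuous_const)
  unfold gaussianDensity
  fun_prop

open scoped MatrixOrder in
-- Factor C⁻¹ = BᵀB and substitute v = B(x - μ); the Jacobian |det B|⁻¹ is the square root of det C
-- and cancels it in the normalizing constant.
theorem lintegral_gaussianDensity (μ : Vec d) {C : Mat d} (hC : C.PosDef) :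
    ∫⁻ x, ENNReal.ofReal (gaussianDensity μ C x) = 1 := by
  obtain ⟨B, hB⟩ := CStarAlgebra.nonneg_iff_eq_star_mul_self.1 hC.inv.posSemidef.nonneg
  replace hB : C⁻¹ = Bᵀ * B := by simpa [Matrix.star_eq_conjTranspose] using hB
  have hdet : C.det = (B.det ^ 2)⁻¹ := by
    have := congrArg Matrix.det hB
    rw [Matrix.det_nonsing_inv, Matrix.det_mul, Matrix.det_transpose,
      Ring.inverse_eq_inv'] at this
    rw [← inv_inv C.det, this, sq]
  have hB0 : B.det ≠ 0 := by
    intro h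
    have := hC.det_pos
    rw [hdet, h] at this
    simp at this
  set c : ℝ := (Real.sqrt ((2 * Real.pi) ^ d * C.det))⁻¹ with hc
  have hc0 : 0 ≤ c := by positivity
  have e1 : ∀ x, gaussianDensity μ C x
      = c * Real.exp (-(1 / 2) * ‖Matrix.toEuclideanCLM (𝕜 := ℝ) B (x - μ)‖ ^ 2) := fun x => by
    rw [gaussianDensity, hB, normSq_transpose_mul_self]
    congr 2
    ring
  have e2 : ∫⁻ v : Vec d, ENNReal.ofReal (Real.exp (-(1 / 2) * ‖v‖ ^ 2))
      = ENNReal.ofReal ((2 * Real.pi) ^ (d / 2 : ℝ)) := by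
    have h := GaussianFourier.integral_rexp_neg_mul_sq_norm (V := Vec d) (b := 1 / 2) (by norm_num)
    rw [← ofReal_integral_eq_lintegral_ofReal, h]
    · simp
      congr 2
      ring
    · refine Integrable.of_integral_ne_zero ?_
      rw [h]
      positivity
    · exact ae_of_all _ fun v => (Real.exp_pos _).le
  simp_rw [e1, ENNReal.ofReal_mul hc0]
  rw [lintegral_const_mul _ (by fun_prop),
    lintegral_sub_right_eq_self (fun x => ENNReal.ofReal
      (Real.exp (-(1 / 2) * ‖Matrix.toEuclideanCLM (𝕜 := ℝ) B x‖ ^ 2)))]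
  have hmap := Measure.map_linearMap_addHaar_eq_smul_addHaar (volume : Measure (Vec d))
    (f := (Matrix.toEuclideanCLM (𝕜 := ℝ) B : Vec d →ₗ[ℝ] Vec d)) (by
      rw [Matrix.coe_toEuclideanCLM_eq_toEuclideanLin, Matrix.toEuclideanLin_eq_toLin_orthonormal,
        LinearMap.det_toLin]
      exact hB0)
  have e3 := lintegral_map (μ := (volume : Measure (Vec d)))
    (f := fun v : Vec d => ENNReal.ofReal (Real.exp (-(1 / 2) * ‖v‖ ^ 2)))
    (g := (Matrix.toEuclideanCLM (𝕜 := ℝ) B : Vec d →ₗ[ℝ] Vec d)) (by fun_prop)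
    (Matrix.toEuclideanCLM (𝕜 := ℝ) B).measurable
  rw [hmap, lintegral_smul_measure, e2] at e3
  refine (congrArg _ e3.symm).trans ?_
  rw [Matrix.coe_toEuclideanCLM_eq_toEuclideanLin, Matrix.toEuclideanLin_eq_toLin_orthonormal,
    LinearMap.det_toLin, smul_eq_mul, ← ENNReal.ofReal_mul (by positivity),
    ← ENNReal.ofReal_mul hc0, hc, hdet, Real.sqrt_mul (by positivity), Real.sqrt_inv,
    Real.sqrt_sq_eq_abs, abs_inv, ENNReal.ofReal_eq_one, Real.sqrt_eq_rpow, ← Real.rpow_natCast,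
    ← Real.rpow_mul (by positivity)]
  have : (d : ℝ) * (1 / 2) = d / 2 := by ring
  rw [this]
  have : 0 < (2 * Real.pi) ^ (d / 2 : ℝ) := by positivity
  have : 0 < |B.det| := abs_pos.2 hB0
  field_simp

/-! ### Transitions and reversibility -/

theorem isProbabilityMeasure_densityMeasure {f : Vec d → ℝ}
    (h : ∫⁻ x, ENNReal.ofReal (f x) = 1) : IsProbabilityMeasure (densityMeasure f) :=
  ⟨by rw [densityMeasure, withDensity_apply _ MeasurableSet.univ, Measure.restrict_univ, h]⟩

theorem lintegral_densityMeasure {f : Vec d → ℝ} (hf : Measurable f) {g : Vec d → ℝ≥0∞}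
    (hg : Measurable g) :
    ∫⁻ x, g x ∂(densityMeasure f) = ∫⁻ x, ENNReal.ofReal (f x) * g x := by
  rw [densityMeasure, lintegral_withDensity_eq_lintegral_mul _ (by fun_prop) hg]
  rfl

theorem lintegral_transition {f : Vec d → ℝ} (hf : Measurable f) (S : Mat d) (x : Vec d)
    {g : Vec d → ℝ≥0∞} (hg : Measurable g) :
    ∫⁻ x', g x' ∂(transition f S x)
      = ∫⁻ ε, ENNReal.ofReal (accept f x (x + Matrix.toEuclideanCLM (𝕜 := ℝ) S ε))
            * g (x + Matrix.toEuclideanCLM (𝕜 := ℝ) S ε) ∂(stdGaussian (Vec d))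
        + (1 - ∫⁻ ε, ENNReal.ofReal (accept f x (x + Matrix.toEuclideanCLM (𝕜 := ℝ) S ε))
            ∂(stdGaussian (Vec d))) * g x := by
  have ha : Measurable fun x' => ENNReal.ofReal (accept f x x') :=
    (measurable_accept hf).comp measurable_prodMk_left
  rw [transition, lintegral_add_measure, lintegral_smul_measure, lintegral_dirac' _ hg,
    lintegral_withDensity_eq_lintegral_mul _ ha hg, lintegral_proposal S x (ha.mul hg),
    lintegral_proposal S x ha]
  rfl

/-- Rejection is moved inside the noise integral, so that one transition is an average over ε of an
expression involving only accept and g. Continuity in S and comparison of targets are both read off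
from it. -/
theorem integral_transition {f : Vec d → ℝ} (hf : Measurable f) (hf0 : ∀ x, 0 ≤ f x) (S : Mat d)
    (x : Vec d) {g : Vec d → ℝ} (hg : Measurable g) {B : ℝ} (hB : ∀ x, |g x| ≤ B) :
    ∫ x', g x' ∂(transition f S x)
      = ∫ ε, (accept f x (x + Matrix.toEuclideanCLM (𝕜 := ℝ) S ε)
            * g (x + Matrix.toEuclideanCLM (𝕜 := ℝ) S ε)
          + (1 - accept f x (x + Matrix.toEuclideanCLM (𝕜 := ℝ) S ε)) * g x)
          ∂(stdGaussian (Vec d)) := by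
  have ha : Measurable fun x' => accept f x x' :=
    (measurable_accept_real hf).comp measurable_prodMk_left
  have ha1 : ∀ x', |accept f x x'| ≤ 1 := fun x' =>
    abs_le.2 ⟨by linarith [accept_nonneg hf0 x x'], accept_le_one f x x'⟩
  have hm : Measurable fun ε : Vec d => x + Matrix.toEuclideanCLM (𝕜 := ℝ) S ε := by fun_prop
  have hia : Integrable (fun ε => accept f x (x + Matrix.toEuclideanCLM (𝕜 := ℝ) S ε))
      (stdGaussian (Vec d)) :=
    Integrable.of_bound (ha.comp hm).aestronglyMeasurable 1 (ae_of_all _ fun ε => ha1 _)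
  have hiag : Integrable (fun ε => accept f x (x + Matrix.toEuclideanCLM (𝕜 := ℝ) S ε)
      * g (x + Matrix.toEuclideanCLM (𝕜 := ℝ) S ε)) (stdGaussian (Vec d)) :=
    hia.mul_bdd (c := B) (hg.comp hm).aestronglyMeasurable (ae_of_all _ fun ε => hB _)
  have hgw : ∀ (μ : Measure (Vec d)) [IsFiniteMeasure μ], Integrable g μ := fun μ _ =>
    Integrable.of_bound hg.aestronglyMeasurable B (ae_of_all _ hB)
  have hA : ∫⁻ x', ENNReal.ofReal (accept f x x') ∂(proposal S x)
      = ENNReal.ofReal (∫ ε, accept f x (x + Matrix.toEuclideanCLM (𝕜 := ℝ) S ε)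
        ∂(stdGaussian (Vec d))) := by
    rw [lintegral_proposal S x ha.ennreal_ofReal, ofReal_integral_eq_lintegral_ofReal hia]
    exact ae_of_all _ fun ε => accept_nonneg hf0 _ _
  have hA1 : ∫ ε, accept f x (x + Matrix.toEuclideanCLM (𝕜 := ℝ) S ε) ∂(stdGaussian (Vec d))
      ≤ 1 := by
    calc _ ≤ ∫ ε, (1 : ℝ) ∂(stdGaussian (Vec d)) :=
          integral_mono hia (integrable_const _) fun ε => accept_le_one _ _ _
      _ = 1 := by simp
  have hfin : IsFiniteMeasure ((proposal S x).withDensity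
      fun x' => ENNReal.ofReal (accept f x x')) :=
    isFiniteMeasure_withDensity (by rw [hA]; exact ENNReal.ofReal_ne_top)
  have hc : (1 - ∫⁻ x', ENNReal.ofReal (accept f x x') ∂(proposal S x)) ≠ ∞ := by simp
  have hR : ∫ ε, (accept f x (x + Matrix.toEuclideanCLM (𝕜 := ℝ) S ε)
            * g (x + Matrix.toEuclideanCLM (𝕜 := ℝ) S ε)
          + (1 - accept f x (x + Matrix.toEuclideanCLM (𝕜 := ℝ) S ε)) * g x)
          ∂(stdGaussian (Vec d))
      = ∫ ε, accept f x (x + Matrix.toEuclideanCLM (𝕜 := ℝ) S ε)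
            * g (x + Matrix.toEuclideanCLM (𝕜 := ℝ) S ε) ∂(stdGaussian (Vec d))
        + (1 - ∫ ε, accept f x (x + Matrix.toEuclideanCLM (𝕜 := ℝ) S ε) ∂(stdGaussian (Vec d)))
          * g x := by
    have h1 : Integrable (fun ε => 1 - accept f x (x + Matrix.toEuclideanCLM (𝕜 := ℝ) S ε))
        (stdGaussian (Vec d)) := (integrable_const _).sub hia
    rw [integral_add hiag (h1.mul_const _), integral_mul_const,
      integral_sub (integrable_const _) hia]
    simp
  rw [transition, integral_add_measure (hgw _) ((hgw _).smul_measure hc), integral_smul_measure,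
    integral_dirac, integral_withDensity_eq_integral_toReal_smul ha.ennreal_ofReal
      (ae_of_all _ fun _ => ENNReal.ofReal_lt_top), hA,
    hR, proposal, integral_map hm.aemeasurable (by fun_prop)]
  congr 1
  · refine integral_congr_ae (ae_of_all _ fun ε => ?_)
    simp only [smul_eq_mul]
    rw [ENNReal.toReal_ofReal (accept_nonneg hf0 _ _)]
  · rw [← ENNReal.ofReal_one, ← ENNReal.ofReal_sub _
      (integral_nonneg fun ε => accept_nonneg hf0 _ _), ENNReal.toReal_ofReal (by linarith),
      smul_eq_mul]

theorem kernel_apply {f : Vec d → ℝ} (hf : Measurable f) (S : Mat d) (x : Vec d) :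
    kernel f hf S x = transition f S x := rfl

/-- Detailed balance: the accepted flow has the symmetric density min(f(x), f(x')), and the rejected
mass sits on the diagonal. -/
theorem isReversible_kernel {f : Vec d → ℝ} (hf : Measurable f) (hf0 : ∀ x, 0 ≤ f x) (S : Mat d) :
    (kernel f hf S).IsReversible (densityMeasure f) := by
  set r : Vec d → ℝ≥0∞ := fun x =>
    1 - ∫⁻ ε, ENNReal.ofReal (accept f x (x + Matrix.toEuclideanCLM (𝕜 := ℝ) S ε))
            ∂(stdGaussian (Vec d)) with hr
  have hm : Measurable fun p : Vec d × Vec d =>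
      (p.1, p.1 + Matrix.toEuclideanCLM (𝕜 := ℝ) S p.2) := by fun_prop
  have hmr : Measurable r :=
    measurable_const.sub ((measurable_accept hf).comp hm).lintegral_prod_right'
  have key : ∀ {A B : Set (Vec d)}, MeasurableSet A → MeasurableSet B →
      ∫⁻ x in A, kernel f hf S x B ∂(densityMeasure f)
        = (∫⁻ x, ∫⁻ ε, ENNReal.ofReal (min (f x) (f (x + Matrix.toEuclideanCLM (𝕜 := ℝ) S ε)))
            * (A.indicator 1 x * B.indicator 1 (x + Matrix.toEuclideanCLM (𝕜 := ℝ) S ε))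
            ∂(stdGaussian (Vec d)))
          + ∫⁻ x, ENNReal.ofReal (f x) * (r x * (A.indicator 1 x * B.indicator 1 x)) := by
    intro A B hA hB
    have hA1 : Measurable (A.indicator (1 : Vec d → ℝ≥0∞)) := measurable_one.indicator hA
    have hB1 : Measurable (B.indicator (1 : Vec d → ℝ≥0∞)) := measurable_one.indicator hB
    rw [← lintegral_indicator hA, lintegral_densityMeasure hf
      ((Kernel.measurable_coe _ hB).indicator hA), ← lintegral_add_right _ (by fun_prop)]
    refine lintegral_congr fun x => ?_
    have h1 : kernel f hf S x B = ∫⁻ x', B.indicator 1 x' ∂(transition f S x) := by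
      rw [kernel_apply, lintegral_indicator_one hB]
    have h2 : A.indicator (fun x => kernel f hf S x B) x
        = A.indicator 1 x * kernel f hf S x B := by
      by_cases hx : x ∈ A <;> simp [hx]
    have hma : Measurable fun ε =>
        ENNReal.ofReal (accept f x (x + Matrix.toEuclideanCLM (𝕜 := ℝ) S ε)) :=
      (measurable_accept hf).comp (hm.comp measurable_prodMk_left)
    rw [h2, h1, lintegral_transition hf S x hB1, mul_add, mul_add, ← lintegral_const_mul _
      (by fun_prop), ← lintegral_const_mul _ (by fun_prop)]
    congr 1
    · refine lintegral_congr fun ε => ?_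
      rw [← mul_accept hf0, ENNReal.ofReal_mul (hf0 x)]
      ring
    · simp only [hr]
      ring
  intro A B hA hB
  have hA1 : Measurable (A.indicator (1 : Vec d → ℝ≥0∞)) := measurable_one.indicator hA
  have hB1 : Measurable (B.indicator (1 : Vec d → ℝ≥0∞)) := measurable_one.indicator hB
  rw [key hA hB, key hB hA]
  congr 1
  · rw [lintegral_lintegral_shift_swap S (G := fun x x' => ENNReal.ofReal (min (f x) (f x'))
      * (A.indicator 1 x * B.indicator 1 x')) (by fun_prop)]
    refine lintegral_congr fun x => lintegral_congr fun ε => ?_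
    rw [min_comm, mul_comm (A.indicator _ _)]
  · refine lintegral_congr fun x => ?_
    rw [mul_comm (A.indicator _ _)]

theorem invariant_kernel {f : Vec d → ℝ} (hf : Measurable f) (hf0 : ∀ x, 0 ≤ f x) (S : Mat d) :
    (kernel f hf S).Invariant (densityMeasure f) :=
  (isReversible_kernel hf hf0 S).invariant

/-! ### Paths, the Markov property and stationarity -/

/-- The paths in `ℝ^d` of length `k`, with states indexed by `0, …, k`. -/
abbrev Trajectory (d k : ℕ) : Type := (i : Finset.Iic k) → Vec d

/-- The initial segment up to time `k` of an infinite path. -/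
def initial (k : ℕ) (z : ℕ → Vec d) : Trajectory d k := fun i => z i

/-- The final state of a path. -/
def Trajectory.last {k : ℕ} (p : Trajectory d k) : Vec d := p ⟨k, Finset.mem_Iic.2 le_rfl⟩

/-- The path that continues `p` with the state `x`. -/
def Trajectory.extend {k : ℕ} (p : Trajectory d k) (x : Vec d) : Trajectory d (k + 1) :=
  fun i => if h : i.1 ≤ k then p ⟨i.1, Finset.mem_Iic.2 h⟩ else x

theorem continuous_extend {k : ℕ} :
    Continuous (fun q : Trajectory d k × Vec d => q.1.extend q.2) := by
  refine continuous_pi fun i => ?_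
  unfold Trajectory.extend
  split_ifs <;> fun_prop

theorem continuous_last {k : ℕ} : Continuous (Trajectory.last : Trajectory d k → Vec d) :=
  continuous_apply _

theorem measurable_initial (k : ℕ) : Measurable (initial k : (ℕ → Vec d) → Trajectory d k) :=
  measurable_pi_lambda _ fun _ => measurable_pi_apply _

theorem last_initial (k : ℕ) (z : ℕ → Vec d) : (initial k z).last = z k := rfl

theorem initial_succ (k : ℕ) (z : ℕ → Vec d) :
    initial (k + 1) z = (initial k z).extend (z (k + 1)) := by
  funext ⟨i, hi⟩
  simp only [initial, Trajectory.extend]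
  split_ifs with h
  · rfl
  · have : i = k + 1 := le_antisymm (Finset.mem_Iic.1 hi) (by omega)
    rw [this]

/-- The transition kernel of the chain, as a kernel on paths of length `k`. -/
noncomputable def trajectoryKernel (f : Vec d → ℝ) (hf : Measurable f) (S : Mat d) (k : ℕ) :
    Kernel (Trajectory d k) (Vec d) :=
  (kernel f hf S).comap (fun path : (i : Finset.Iic k) → Vec d => path ⟨k, Finset.mem_Iic.2 le_rfl⟩)
      (measurable_pi_apply _)

instance isMarkovKernel_trajectoryKernel (f : Vec d → ℝ) (hf : Measurable f) (S : Mat d) (k : ℕ) :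
    IsMarkovKernel (trajectoryKernel f hf S k) := by
  unfold trajectoryKernel
  infer_instance

section

variable {f : Vec d → ℝ} (hf : Measurable f) (S : Mat d)

theorem isProbabilityMeasure_chainLaw (h1 : ∫⁻ x, ENNReal.ofReal (f x) = 1) :
    IsProbabilityMeasure (chainLaw f hf S) := by
  have := isProbabilityMeasure_densityMeasure h1
  unfold chainLaw
  infer_instance

theorem compProd_chainLaw (h1 : ∫⁻ x, ENNReal.ofReal (f x) = 1) (k : ℕ) :
    (chainLaw f hf S).map (initial k) ⊗ₘ trajectoryKernel f hf S k
      = (chainLaw f hf S).map (fun z => (initial k z, z (k + 1))) := by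
  have := isProbabilityMeasure_densityMeasure h1
  exact Kernel.map_frestrictLe_trajMeasure_compProd_eq_map_trajMeasure
    (X := fun _ => Vec d) (κ := fun k => trajectoryKernel f hf S k) (μ₀ := densityMeasure f) (a := k)

theorem lintegral_chainLaw_succ (h1 : ∫⁻ x, ENNReal.ofReal (f x) = 1) (k : ℕ)
    {G : Trajectory d k × Vec d → ℝ≥0∞} (hG : Measurable G) :
    ∫⁻ z, G (initial k z, z (k + 1)) ∂(chainLaw f hf S)
      = ∫⁻ z, ∫⁻ x', G (initial k z, x') ∂(transition f S (z k)) ∂(chainLaw f hf S) := by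
  have := isProbabilityMeasure_chainLaw hf S h1
  have hm : Measurable fun z : ℕ → Vec d => (initial k z, z (k + 1)) :=
    (measurable_initial k).prodMk (measurable_pi_apply _)
  rw [← lintegral_map hG hm, ← compProd_chainLaw hf S h1, Measure.lintegral_compProd hG,
    lintegral_map _ (measurable_initial k)]
  · rfl
  · exact hG.lintegral_kernel_prod_right'

theorem integral_chainLaw_succ (h1 : ∫⁻ x, ENNReal.ofReal (f x) = 1) (k : ℕ)
    {G : Trajectory d k × Vec d → ℝ} (hG : Measurable G) {B : ℝ} (hB : ∀ p, |G p| ≤ B) :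
    ∫ z, G (initial k z, z (k + 1)) ∂(chainLaw f hf S)
      = ∫ z, ∫ x', G (initial k z, x') ∂(transition f S (z k)) ∂(chainLaw f hf S) := by
  have := isProbabilityMeasure_chainLaw hf S h1
  have hm : Measurable fun z : ℕ → Vec d => (initial k z, z (k + 1)) :=
    (measurable_initial k).prodMk (measurable_pi_apply _)
  have := Measure.isProbabilityMeasure_map (μ := chainLaw f hf S) (measurable_initial k).aemeasurable
  rw [← integral_map hm.aemeasurable hG.aestronglyMeasurable, ← compProd_chainLaw hf S h1,
    Measure.integral_compProd, integral_map (measurable_initial k).aemeasurable]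
  · rfl
  · exact (hG.stronglyMeasurable.integral_kernel_prod_right').aestronglyMeasurable
  · exact Integrable.of_bound hG.aestronglyMeasurable B (ae_of_all _ hB)

theorem map_eval_zero_chainLaw :
    (chainLaw f hf S).map (fun z => z 0) = densityMeasure f := by
  have hm : Measurable fun p : Trajectory d 0 => p ⟨0, Finset.mem_Iic.2 le_rfl⟩ := measurable_pi_apply _
  -- The Ionescu-Tulcea construction starts from a law on paths indexed by the single time 0, so the
  -- initial law is transported along that identification.
  have h0 : (chainLaw f hf S).map (initial 0)
      = (densityMeasure f).map (MeasurableEquiv.piUnique (fun _ : Finset.Iic 0 => Vec d)).symm := by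
    have := Kernel.traj_map_frestrictLe (X := fun _ => Vec d)
      (κ := fun k => trajectoryKernel f hf S k) 0 0
    rw [Kernel.partialTraj_self] at this
    calc (chainLaw f hf S).map (initial 0)
        = (Kernel.map (Kernel.traj (X := fun _ => Vec d) (fun k => trajectoryKernel f hf S k) 0)
            (Preorder.frestrictLe 0)) ∘ₘ ((densityMeasure f).map
              (MeasurableEquiv.piUnique (fun _ : Finset.Iic 0 => Vec d)).symm) :=
          Measure.map_comp _ _ (measurable_initial 0)
      _ = _ := by rw [this, Measure.id_comp]
  have h2 : (chainLaw f hf S).map (fun z => z 0)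
      = ((chainLaw f hf S).map (initial 0)).map (fun p => p ⟨0, Finset.mem_Iic.2 le_rfl⟩) := by
    rw [Measure.map_map hm (measurable_initial 0)]
    rfl
  rw [h2, h0, Measure.map_map hm (MeasurableEquiv.measurable _)]
  exact Measure.map_id

/-- Stationarity by induction from invariance. It lets the error made at any time be integrated
against the target density. -/
theorem map_eval_chainLaw (hf0 : ∀ x, 0 ≤ f x) (h1 : ∫⁻ x, ENNReal.ofReal (f x) = 1) (k : ℕ) :
    (chainLaw f hf S).map (fun z => z k) = densityMeasure f := by
  induction k with
  | zero => exact map_eval_zero_chainLaw hf S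
  | succ k ih =>
    ext s hs
    have hs1 : Measurable (s.indicator (1 : Vec d → ℝ≥0∞)) := measurable_one.indicator hs
    have h := lintegral_chainLaw_succ hf S h1 k (G := fun q => s.indicator 1 q.2) (by fun_prop)
    rw [← lintegral_indicator_one hs, lintegral_map hs1 (measurable_pi_apply (k + 1)), h]
    simp_rw [lintegral_indicator_one hs]
    rw [← lintegral_map (μ := chainLaw f hf S) (f := fun x => transition f S x s)
      (g := fun z => z k) (Kernel.measurable_coe (kernel f hf S) hs) (measurable_pi_apply k), ih]
    have h3 := invariant_kernel hf hf0 S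
    conv_rhs => rw [← h3.def, Measure.bind_apply hs (Kernel.aemeasurable _)]
    rfl

theorem lintegral_chainLaw_eval (hf0 : ∀ x, 0 ≤ f x) (h1 : ∫⁻ x, ENNReal.ofReal (f x) = 1)
    (k : ℕ) {g : Vec d → ℝ≥0∞} (hg : Measurable g) :
    ∫⁻ z, g (z k) ∂(chainLaw f hf S) = ∫⁻ x, ENNReal.ofReal (f x) * g x := by
  rw [← lintegral_densityMeasure hf hg, ← map_eval_chainLaw hf S hf0 h1 k,
    lintegral_map hg (measurable_pi_apply k)]

end

/-! ### Stability in L¹ under a change of target -/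

/-- The `L¹`-distance of two functions on `ℝ^d`, with values in `[0, ∞]`. -/
noncomputable def l1Dist (f g : Vec d → ℝ) : ℝ≥0∞ := ∫⁻ x, ‖f x - g x‖ₑ

theorem enorm_min_sub_min_le (a b a' b' : ℝ) :
    ‖min a b - min a' b'‖ₑ ≤ ‖a - a'‖ₑ + ‖b - b'‖ₑ := by
  rw [Real.enorm_eq_ofReal_abs, Real.enorm_eq_ofReal_abs, Real.enorm_eq_ofReal_abs,
    ← ENNReal.ofReal_add (abs_nonneg _) (abs_nonneg _)]
  exact ENNReal.ofReal_le_ofReal ((abs_min_sub_min_le_max a b a' b').trans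
    (max_le_add_of_nonneg (abs_nonneg _) (abs_nonneg _)))

theorem measurable_accept_shift {f : Vec d → ℝ} (hf : Measurable f) (S : Mat d) (x : Vec d) :
    Measurable fun ε => accept f x (x + Matrix.toEuclideanCLM (𝕜 := ℝ) S ε) :=
  (measurable_accept_real hf).comp
    (f := fun ε => (x, x + Matrix.toEuclideanCLM (𝕜 := ℝ) S ε)) (by fun_prop)

theorem measurable_enorm_accept_sub {f g : Vec d → ℝ} (hf : Measurable f) (hg : Measurable g)
    (S : Mat d) (x : Vec d) :
    Measurable fun ε => ‖accept f x (x + Matrix.toEuclideanCLM (𝕜 := ℝ) S ε)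
      - accept g x (x + Matrix.toEuclideanCLM (𝕜 := ℝ) S ε)‖ₑ :=
  ((measurable_accept_shift hf S x).sub (measurable_accept_shift hg S x)).enorm

section

variable {f g : Vec d → ℝ} (hf : Measurable f) (hf0 : ∀ x, 0 ≤ f x)
  (hg : Measurable g) (hg0 : ∀ x, 0 ≤ g x) (S : Mat d)

include hf hf0 hg hg0

/-- By `mul_accept` this is a difference of minima, bounded by the error at x plus the error at x +
Sε. Each contributes one L¹-distance, the second after a translation, whence the 2. The weight w is
there for the jumping distance. -/
theorem lintegral_enorm_mul_accept_sub_le {w : Vec d → ℝ≥0∞} (hw : Measurable w) :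
    ∫⁻ x, ∫⁻ ε, ‖f x * accept f x (x + Matrix.toEuclideanCLM (𝕜 := ℝ) S ε)
        - g x * accept g x (x + Matrix.toEuclideanCLM (𝕜 := ℝ) S ε)‖ₑ * w ε
        ∂(stdGaussian (Vec d))
      ≤ 2 * l1Dist f g * ∫⁻ ε, w ε ∂(stdGaussian (Vec d)) := by
  have hfg : Measurable fun x => ‖f x - g x‖ₑ := (hf.sub hg).enorm
  calc _ ≤ ∫⁻ x, ∫⁻ ε, (‖f x - g x‖ₑ * w ε
          + ‖f (x + Matrix.toEuclideanCLM (𝕜 := ℝ) S ε)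
            - g (x + Matrix.toEuclideanCLM (𝕜 := ℝ) S ε)‖ₑ * w ε) ∂(stdGaussian (Vec d)) := by
        refine lintegral_mono fun x => lintegral_mono fun ε => ?_
        dsimp only
        rw [mul_accept hf0, mul_accept hg0, ← add_mul]
        exact mul_le_mul_left (enorm_min_sub_min_le _ _ _ _) _
    _ = (∫⁻ x, ‖f x - g x‖ₑ * ∫⁻ ε, w ε ∂(stdGaussian (Vec d)))
          + ∫⁻ x, ∫⁻ ε, ‖f (x + Matrix.toEuclideanCLM (𝕜 := ℝ) S ε)
            - g (x + Matrix.toEuclideanCLM (𝕜 := ℝ) S ε)‖ₑ * w ε ∂(stdGaussian (Vec d)) := by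
        rw [← lintegral_add_left (by fun_prop)]
        refine lintegral_congr fun x => ?_
        rw [lintegral_add_left (by fun_prop), lintegral_const_mul _ hw]
    _ = 2 * l1Dist f g * ∫⁻ ε, w ε ∂(stdGaussian (Vec d)) := by
        rw [lintegral_mul_const _ hfg, lintegral_lintegral_shift_mul S hfg hw, l1Dist]
        ring

theorem lintegral_mul_enorm_accept_sub_le {w : Vec d → ℝ≥0∞} (hw : Measurable w) :
    ∫⁻ x, ENNReal.ofReal (f x) * ∫⁻ ε,
        ‖accept f x (x + Matrix.toEuclideanCLM (𝕜 := ℝ) S ε)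
        - accept g x (x + Matrix.toEuclideanCLM (𝕜 := ℝ) S ε)‖ₑ * w ε
        ∂(stdGaussian (Vec d))
      ≤ 3 * l1Dist f g * ∫⁻ ε, w ε ∂(stdGaussian (Vec d)) := by
  have hfg : Measurable fun x => ‖f x - g x‖ₑ := (hf.sub hg).enorm
  calc _ ≤ ∫⁻ x, ∫⁻ ε, (‖f x - g x‖ₑ * w ε
          + ‖f x * accept f x (x + Matrix.toEuclideanCLM (𝕜 := ℝ) S ε)
        - g x * accept g x (x + Matrix.toEuclideanCLM (𝕜 := ℝ) S ε)‖ₑ * w ε)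
          ∂(stdGaussian (Vec d)) := by
        refine lintegral_mono fun x => ?_
        dsimp only
        have hx := measurable_enorm_accept_sub hf hg S x
        rw [← lintegral_const_mul _ (by fun_prop)]
        refine lintegral_mono fun ε => ?_
        rw [← mul_assoc, ← add_mul]
        refine mul_le_mul_left ?_ _
        set a := accept f x (x + Matrix.toEuclideanCLM (𝕜 := ℝ) S ε)
        set b := accept g x (x + Matrix.toEuclideanCLM (𝕜 := ℝ) S ε) with hb
        have hb0 : 0 ≤ b := accept_nonneg hg0 _ _
        have hb1 : b ≤ 1 := accept_le_one _ _ _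
        simp only [Real.enorm_eq_ofReal_abs]
        rw [← ENNReal.ofReal_mul (hf0 x), ← ENNReal.ofReal_add (abs_nonneg _) (abs_nonneg _)]
        refine ENNReal.ofReal_le_ofReal ?_
        calc f x * |a - b| = |f x * (a - b)| := by rw [abs_mul, abs_of_nonneg (hf0 x)]
          -- This splitting costs one L¹-distance beyond the two of the preceding lemma, which
          -- explains the constant 3.
          _ = |(g x - f x) * b + (f x * a - g x * b)| := by congr 1; ring
          _ ≤ |(g x - f x) * b| + |f x * a - g x * b| := abs_add_le _ _
          _ ≤ |f x - g x| + |f x * a - g x * b| := by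
            rw [abs_mul, abs_of_nonneg hb0, abs_sub_comm (g x)]
            gcongr
            exact mul_le_of_le_one_right (abs_nonneg _) hb1
    _ = (∫⁻ x, ‖f x - g x‖ₑ * ∫⁻ ε, w ε ∂(stdGaussian (Vec d)))
          + ∫⁻ x, ∫⁻ ε, ‖f x * accept f x (x + Matrix.toEuclideanCLM (𝕜 := ℝ) S ε)
        - g x * accept g x (x + Matrix.toEuclideanCLM (𝕜 := ℝ) S ε)‖ₑ * w ε
          ∂(stdGaussian (Vec d)) := by
        rw [← lintegral_add_left (by fun_prop)]
        refine lintegral_congr fun x => ?_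
        rw [lintegral_add_left (by fun_prop), lintegral_const_mul _ hw]
    _ ≤ l1Dist f g * (∫⁻ ε, w ε ∂(stdGaussian (Vec d)))
          + 2 * l1Dist f g * ∫⁻ ε, w ε ∂(stdGaussian (Vec d)) := by
        rw [lintegral_mul_const _ hfg]
        exact add_le_add le_rfl (lintegral_enorm_mul_accept_sub_le hf hf0 hg hg0 S hw)
    _ = _ := by ring

theorem enorm_integral_transition_sub_le (x : Vec d) {h : Vec d → ℝ} (hh : Measurable h) {B : ℝ}
    (hB : ∀ x, |h x| ≤ B) :
    ‖∫ x', h x' ∂(transition f S x) - ∫ x', h x' ∂(transition g S x)‖ₑ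
      ≤ ENNReal.ofReal (2 * B) * ∫⁻ ε,
        ‖accept f x (x + Matrix.toEuclideanCLM (𝕜 := ℝ) S ε)
        - accept g x (x + Matrix.toEuclideanCLM (𝕜 := ℝ) S ε)‖ₑ ∂(stdGaussian (Vec d)) := by
  have hm : Measurable fun ε : Vec d => x + Matrix.toEuclideanCLM (𝕜 := ℝ) S ε := by fun_prop
  have hB0 : 0 ≤ B := (abs_nonneg _).trans (hB 0)
  have hint : ∀ {u : Vec d → ℝ}, Measurable u → (∀ x, 0 ≤ u x) → Integrable (fun ε =>
      accept u x (x + Matrix.toEuclideanCLM (𝕜 := ℝ) S ε)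
            * h (x + Matrix.toEuclideanCLM (𝕜 := ℝ) S ε)
          + (1 - accept u x (x + Matrix.toEuclideanCLM (𝕜 := ℝ) S ε)) * h x)
      (stdGaussian (Vec d)) := by
    intro u hu hu0
    have hau := measurable_accept_shift hu S x
    refine Integrable.of_bound (by fun_prop) (B + B) (ae_of_all _ fun ε => ?_)
    have h0 := accept_nonneg hu0 x (x + Matrix.toEuclideanCLM (𝕜 := ℝ) S ε)
    have h1 := accept_le_one u x (x + Matrix.toEuclideanCLM (𝕜 := ℝ) S ε)
    refine (norm_add_le _ _).trans (add_le_add ?_ ?_)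
    · rw [norm_mul, Real.norm_of_nonneg h0]
      exact (mul_le_of_le_one_left (norm_nonneg _) h1).trans (hB _)
    · rw [norm_mul, Real.norm_of_nonneg (by linarith)]
      exact (mul_le_of_le_one_left (norm_nonneg _) (by linarith)).trans (hB _)
  rw [integral_transition hf hf0 S x hh hB, integral_transition hg hg0 S x hh hB,
    ← integral_sub (hint hf hf0) (hint hg hg0),
    ← lintegral_const_mul _ (measurable_enorm_accept_sub hf hg S x)]
  refine (enorm_integral_le_lintegral_enorm _).trans (lintegral_mono fun ε => ?_)
  simp only [Real.enorm_eq_ofReal_abs]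
  rw [← ENNReal.ofReal_mul (by linarith)]
  refine ENNReal.ofReal_le_ofReal ?_
  set x' := x + Matrix.toEuclideanCLM (𝕜 := ℝ) S ε
  -- Changing the acceptance probability only moves mass between x' and x, so h enters through its
  -- oscillation, at most 2B.
  calc _ = |(h x' - h x) * (accept f x x' - accept g x x')| := by congr 1; ring
    _ ≤ 2 * B * |accept f x x' - accept g x x'| := by
      rw [abs_mul]
      gcongr
      have := abs_sub (h x') (h x)
      linarith [hB x, hB x']

end

theorem enorm_integral_densityMeasure_sub_le {f g : Vec d → ℝ} (hf : Measurable f)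
    (hf0 : ∀ x, 0 ≤ f x) (hfi : Integrable f) (hg : Measurable g) (hg0 : ∀ x, 0 ≤ g x)
    (hgi : Integrable g) {h : Vec d → ℝ} (hh : Measurable h) {B : ℝ} (hB : ∀ x, |h x| ≤ B) :
    ‖∫ x, h x ∂(densityMeasure f) - ∫ x, h x ∂(densityMeasure g)‖ₑ
      ≤ ENNReal.ofReal B * l1Dist f g := by
  have key : ∀ {u : Vec d → ℝ}, Measurable u → (∀ x, 0 ≤ u x) →
      ∫ x, h x ∂(densityMeasure u) = ∫ x, u x * h x := fun {u} hu hu0 => by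
    rw [densityMeasure, integral_withDensity_eq_integral_toReal_smul hu.ennreal_ofReal
      (ae_of_all _ fun _ => ENNReal.ofReal_lt_top)]
    refine integral_congr_ae (ae_of_all _ fun x => ?_)
    simp [ENNReal.toReal_ofReal (hu0 x)]
  have hi : ∀ {u : Vec d → ℝ}, Integrable u → Integrable (fun x => u x * h x) := fun hu =>
    hu.mul_bdd (c := B) hh.aestronglyMeasurable (ae_of_all _ hB)
  have hfg : Measurable fun x => ‖f x - g x‖ₑ := (hf.sub hg).enorm
  rw [key hf hf0, key hg hg0, ← integral_sub (hi hfi) (hi hgi), l1Dist,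
    ← lintegral_const_mul _ hfg]
  refine (enorm_integral_le_lintegral_enorm _).trans (lintegral_mono fun x => ?_)
  rw [← sub_mul, enorm_mul, mul_comm]
  refine mul_le_mul_left ?_ _
  rw [Real.enorm_eq_ofReal_abs]
  exact ENNReal.ofReal_le_ofReal (hB x)

theorem integrable_of_lintegral_eq_one {f : Vec d → ℝ} (hf : Measurable f) (hf0 : ∀ x, 0 ≤ f x)
    (hf1 : ∫⁻ x, ENNReal.ofReal (f x) = 1) : Integrable f := by
  refine ⟨hf.aestronglyMeasurable, ?_⟩
  rw [hasFiniteIntegral_iff_ofReal (ae_of_all _ hf0), hf1]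
  exact ENNReal.one_lt_top

theorem measurable_extend {k : ℕ} (p : Trajectory d k) : Measurable p.extend :=
  (continuous_extend.comp (Continuous.prodMk_right p)).measurable

theorem initial_zero (z : ℕ → Vec d) : initial 0 z = fun _ => z 0 := by
  funext ⟨i, hi⟩
  have : i = 0 := Nat.le_zero.1 (Finset.mem_Iic.1 hi)
  simp [initial, this]

theorem measurable_integral_transition_extend {f : Vec d → ℝ} (hf : Measurable f) (S : Mat d)
    {k : ℕ} {H : Trajectory d (k + 1) → ℝ} (hH : Measurable H) :
    Measurable fun p : Trajectory d k => ∫ x', H (p.extend x') ∂(transition f S p.last) :=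
  ((hH.comp continuous_extend.measurable).stronglyMeasurable.integral_kernel_prod_right'
    (κ := trajectoryKernel f hf S k)).measurable

theorem abs_integral_transition_le {f : Vec d → ℝ} (hf : Measurable f) (S : Mat d) (x : Vec d)
    {h : Vec d → ℝ} {B : ℝ} (hB : ∀ x, |h x| ≤ B) :
    |∫ x', h x' ∂(transition f S x)| ≤ B := by
  have : IsProbabilityMeasure (transition f S x) :=
    (inferInstance : IsProbabilityMeasure (kernel f hf S x))
  have := norm_integral_le_of_norm_le_const (μ := transition f S x) (f := h) (C := B)
    (ae_of_all _ hB)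
  simpa using this

theorem integral_initial_succ {f : Vec d → ℝ} (hf : Measurable f)
    (hf1 : ∫⁻ x, ENNReal.ofReal (f x) = 1) (S : Mat d)
    (k : ℕ) {H : Trajectory d (k + 1) → ℝ} (hH : Measurable H) {B : ℝ} (hB : ∀ p, |H p| ≤ B) :
    ∫ z, H (initial (k + 1) z) ∂(chainLaw f hf S)
      = ∫ z, ∫ x', H ((initial k z).extend x') ∂(transition f S (initial k z).last)
        ∂(chainLaw f hf S) := by
  simp_rw [initial_succ]
  exact integral_chainLaw_succ hf S hf1 k (G := fun q => H (q.1.extend q.2))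
    (hH.comp continuous_extend.measurable) fun _ => hB _

/-- Telescoping over time: the last transition is switched from f to g under the stationary law of
f, and the shorter path is handled by induction. Each switch costs 2B · 3 and the initial law costs
B, whence B(1 + 6k). -/
theorem enorm_integral_chainLaw_sub_le {f g : Vec d → ℝ} (hf : Measurable f)
    (hf0 : ∀ x, 0 ≤ f x) (hf1 : ∫⁻ x, ENNReal.ofReal (f x) = 1)
    (hg : Measurable g) (hg0 : ∀ x, 0 ≤ g x) (hg1 : ∫⁻ x, ENNReal.ofReal (g x) = 1) (S : Mat d)
    (k : ℕ) {H : Trajectory d k → ℝ} (hH : Measurable H) {B : ℝ} (hB : ∀ p, |H p| ≤ B) :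
    ‖∫ z, H (initial k z) ∂(chainLaw f hf S) - ∫ z, H (initial k z) ∂(chainLaw g hg S)‖ₑ
      ≤ ENNReal.ofReal B * (1 + 6 * k) * l1Dist f g := by
  induction k with
  | zero =>
    have hH' : Measurable fun x : Vec d => H fun _ => x := hH.comp (by fun_prop)
    have key : ∀ {u : Vec d → ℝ} (hu : Measurable u),
        ∫ z, H (initial 0 z) ∂(chainLaw u hu S) = ∫ x, H (fun _ => x) ∂(densityMeasure u) :=
      fun hu => by
        rw [← map_eval_zero_chainLaw hu S, integral_map (measurable_pi_apply 0).aemeasurable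
          hH'.aestronglyMeasurable]
        simp_rw [initial_zero]
    rw [key hf, key hg]
    simpa using enorm_integral_densityMeasure_sub_le hf hf0
      (integrable_of_lintegral_eq_one hf hf0 hf1) hg hg0
      (integrable_of_lintegral_eq_one hg hg0 hg1) hH' fun x => hB _
  | succ k ih =>
    have hB0 : 0 ≤ B := (abs_nonneg _).trans (hB fun _ => 0)
    have := isProbabilityMeasure_chainLaw hf S hf1
    rw [integral_initial_succ hf hf1 S k hH hB, integral_initial_succ hg hg1 S k hH hB]
    set Tf : Trajectory d k → ℝ := fun p => ∫ x', H (p.extend x') ∂(transition f S p.last) with hTf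
    set Tg : Trajectory d k → ℝ := fun p => ∫ x', H (p.extend x') ∂(transition g S p.last) with hTg
    have hTfm : Measurable Tf := measurable_integral_transition_extend hf S hH
    have hTgm : Measurable Tg := measurable_integral_transition_extend hg S hH
    have hTfB : ∀ p, |Tf p| ≤ B := fun p => abs_integral_transition_le hf S _ fun _ => hB _
    have hTgB : ∀ p, |Tg p| ≤ B := fun p => abs_integral_transition_le hg S _ fun _ => hB _
    have hi : ∀ {T : Trajectory d k → ℝ}, Measurable T → (∀ p, |T p| ≤ B) →
        Integrable (fun z => T (initial k z)) (chainLaw f hf S) := fun hT hTB =>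
      Integrable.of_bound (hT.comp (measurable_initial k)).aestronglyMeasurable B
        (ae_of_all _ fun z => hTB _)
    have hm : Measurable fun p : Vec d × Vec d =>
        (p.1, p.1 + Matrix.toEuclideanCLM (𝕜 := ℝ) S p.2) := by fun_prop
    have hsub : ‖∫ z, Tf (initial k z) ∂(chainLaw f hf S)
        - ∫ z, Tg (initial k z) ∂(chainLaw f hf S)‖ₑ
        ≤ ENNReal.ofReal (2 * B) * (3 * l1Dist f g) := by
      rw [← integral_sub (hi hTfm hTfB) (hi hTgm hTgB)]
      calc _ ≤ ∫⁻ z, ENNReal.ofReal (2 * B) * ∫⁻ ε,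
              ‖accept f (z k) (z k + Matrix.toEuclideanCLM (𝕜 := ℝ) S ε)
              - accept g (z k) (z k + Matrix.toEuclideanCLM (𝕜 := ℝ) S ε)‖ₑ
              ∂(stdGaussian (Vec d)) ∂(chainLaw f hf S) := by
            refine (enorm_integral_le_lintegral_enorm _).trans (lintegral_mono fun z => ?_)
            exact enorm_integral_transition_sub_le hf hf0 hg hg0 S (z k)
              (h := fun x' => H ((initial k z).extend x'))
              (hH.comp (measurable_extend _)) fun _ => hB _
        -- Stationarity of the chain with target f replaces the law of z k by the density f.
        _ = ENNReal.ofReal (2 * B) * ∫⁻ x, ENNReal.ofReal (f x) * ∫⁻ ε,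
              ‖accept f x (x + Matrix.toEuclideanCLM (𝕜 := ℝ) S ε)
              - accept g x (x + Matrix.toEuclideanCLM (𝕜 := ℝ) S ε)‖ₑ
              ∂(stdGaussian (Vec d)) := by
            have hme : Measurable fun x => ∫⁻ ε,
                ‖accept f x (x + Matrix.toEuclideanCLM (𝕜 := ℝ) S ε)
                - accept g x (x + Matrix.toEuclideanCLM (𝕜 := ℝ) S ε)‖ₑ
                ∂(stdGaussian (Vec d)) :=
              (((measurable_accept_real hf).comp hm).sub
                ((measurable_accept_real hg).comp hm)).enorm.lintegral_prod_right'
            have hme' := hme.comp (measurable_pi_apply (X := fun _ : ℕ => Vec d) k)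
            simp only [Function.comp_def] at hme'
            rw [← lintegral_chainLaw_eval hf S hf0 hf1 k hme,
              lintegral_const_mul _ hme']
        _ ≤ _ := by
            refine mul_le_mul_right ?_ _
            have := lintegral_mul_enorm_accept_sub_le hf hf0 hg hg0 S (w := fun _ => 1)
              measurable_const
            simpa using this
    calc _ ≤ ‖∫ z, Tf (initial k z) ∂(chainLaw f hf S)
              - ∫ z, Tg (initial k z) ∂(chainLaw f hf S)‖ₑ
            + ‖∫ z, Tg (initial k z) ∂(chainLaw f hf S)
              - ∫ z, Tg (initial k z) ∂(chainLaw g hg S)‖ₑ := by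
          rw [← sub_add_sub_cancel _ (∫ z, Tg (initial k z) ∂(chainLaw f hf S))]
          exact enorm_add_le _ _
      _ ≤ ENNReal.ofReal (2 * B) * (3 * l1Dist f g)
            + ENNReal.ofReal B * (1 + 6 * k) * l1Dist f g := add_le_add hsub (ih hTgm hTgB)
      _ = _ := by
          rw [ENNReal.ofReal_mul zero_le_two, ENNReal.ofReal_ofNat]
          push_cast
          ring

/-! ### Continuity in the scaling matrix -/

/-- `continuous_of_dominated` asks for a first-countable parameter space. -/
instance firstCountableTopology_mat : FirstCountableTopology (Mat d) :=
  inferInstanceAs (FirstCountableTopology (Fin d → Fin d → ℝ))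

theorem continuous_toEuclideanCLM_apply :
    Continuous fun q : Mat d × Vec d => Matrix.toEuclideanCLM (𝕜 := ℝ) q.1 q.2 := by
  have h : (fun q : Mat d × Vec d => Matrix.toEuclideanCLM (𝕜 := ℝ) q.1 q.2)
      = fun q => WithLp.toLp 2 (q.1 *ᵥ q.2.ofLp) := by
    funext q
    rw [← Matrix.ofLp_toEuclideanCLM]
  rw [h]
  exact (PiLp.continuous_toLp 2 _).comp
    (continuous_fst.matrix_mulVec ((PiLp.continuous_ofLp 2 _).comp continuous_snd))

theorem continuous_accept {f : Vec d → ℝ} (hf : Continuous f) (hpos : ∀ x, 0 < f x) :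
    Continuous fun p : Vec d × Vec d => accept f p.1 p.2 :=
  continuous_const.min ((hf.comp continuous_snd).div (hf.comp continuous_fst)
    fun p => (hpos p.1).ne')

theorem continuous_integral_transition {f : Vec d → ℝ} (hf : Continuous f) (hpos : ∀ x, 0 < f x)
    {k : ℕ} {H : Mat d × Trajectory d (k + 1) → ℝ} (hH : Continuous H) {B : ℝ} (hB : ∀ q, |H q| ≤ B) :
    Continuous fun q : Mat d × Trajectory d k =>
      ∫ x', H (q.1, q.2.extend x') ∂(transition f q.1 q.2.last) := by
  have h0 : ∀ x, 0 ≤ f x := fun x => (hpos x).le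
  have hext : ∀ q : Mat d × Trajectory d k, Measurable fun x' => H (q.1, q.2.extend x') := fun q =>
    (hH.comp (continuous_const.prodMk
      (continuous_extend.comp (Continuous.prodMk_right q.2)))).measurable
  simp_rw [fun q : Mat d × Trajectory d k => integral_transition hf.measurable h0 q.1 q.2.last
    (hext q) fun _ => hB _]
  have hacc := continuous_accept hf hpos
  have hprop : Continuous fun r : (Mat d × Trajectory d k) × Vec d =>
      r.1.2.last + Matrix.toEuclideanCLM (𝕜 := ℝ) r.1.1 r.2 :=
    (continuous_last.comp (by fun_prop)).add
      (continuous_toEuclideanCLM_apply.comp (f := fun r : (Mat d × Trajectory d k) × Vec d =>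
        (r.1.1, r.2)) (by fun_prop))
  have hlast : Continuous fun r : (Mat d × Trajectory d k) × Vec d => r.1.2.last :=
    continuous_last.comp (by fun_prop)
  have ha : Continuous fun r : (Mat d × Trajectory d k) × Vec d =>
      accept f r.1.2.last (r.1.2.last + Matrix.toEuclideanCLM (𝕜 := ℝ) r.1.1 r.2) :=
    hacc.comp (hlast.prodMk hprop)
  have hH1 : Continuous fun r : (Mat d × Trajectory d k) × Vec d =>
      H (r.1.1, r.1.2.extend (r.1.2.last + Matrix.toEuclideanCLM (𝕜 := ℝ) r.1.1 r.2)) :=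
    hH.comp ((continuous_fst.comp continuous_fst).prodMk (continuous_extend.comp
      ((continuous_snd.comp continuous_fst).prodMk hprop)))
  have hH2 : Continuous fun r : (Mat d × Trajectory d k) × Vec d => H (r.1.1, r.1.2.extend r.1.2.last) :=
    hH.comp ((continuous_fst.comp continuous_fst).prodMk (continuous_extend.comp
      ((continuous_snd.comp continuous_fst).prodMk hlast)))
  have hF := (ha.mul hH1).add ((continuous_const (y := (1 : ℝ)).sub ha).mul hH2)
  refine continuous_of_dominated (bound := fun _ => B + B)
    (fun q => (hF.comp (Continuous.prodMk_right q)).aestronglyMeasurable)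
    (fun q => ae_of_all _ fun ε => ?_) (integrable_const _)
    (ae_of_all _ fun ε => hF.comp (Continuous.prodMk_left ε))
  have h0 := accept_nonneg h0 q.2.last (q.2.last + Matrix.toEuclideanCLM (𝕜 := ℝ) q.1 ε)
  have h1 := accept_le_one f q.2.last (q.2.last + Matrix.toEuclideanCLM (𝕜 := ℝ) q.1 ε)
  refine (norm_add_le _ _).trans (add_le_add ?_ ?_)
  · rw [norm_mul, Real.norm_of_nonneg h0]
    exact (mul_le_of_le_one_left (norm_nonneg _) h1).trans (hB _)
  · rw [norm_mul, Real.norm_of_nonneg (by linarith)]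
    exact (mul_le_of_le_one_left (norm_nonneg _) (by linarith)).trans (hB _)

/-- H may depend on S because integrating out the last transition produces a function of both the
shorter path and S; without this the induction would not close. -/
theorem continuous_integral_chainLaw {f : Vec d → ℝ} (hf : Continuous f) (hpos : ∀ x, 0 < f x)
    (h1 : ∫⁻ x, ENNReal.ofReal (f x) = 1) (k : ℕ) {H : Mat d × Trajectory d k → ℝ} (hH : Continuous H)
    {B : ℝ} (hB : ∀ q, |H q| ≤ B) :
    Continuous fun S : Mat d => ∫ z, H (S, initial k z) ∂(chainLaw f hf.measurable S) := by
  induction k with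
  | zero =>
    have hH' : Continuous fun q : Mat d × Vec d => H (q.1, fun _ => q.2) := hH.comp (by fun_prop)
    have key : ∀ S : Mat d, ∫ z, H (S, initial 0 z) ∂(chainLaw f hf.measurable S)
        = ∫ x, H (S, fun _ => x) ∂(densityMeasure f) := fun S => by
      rw [← map_eval_zero_chainLaw hf.measurable S, integral_map
        (measurable_pi_apply 0).aemeasurable
        (hH'.comp (Continuous.prodMk_right S)).aestronglyMeasurable]
      simp_rw [initial_zero]
    simp_rw [key]
    have := isProbabilityMeasure_densityMeasure h1
    exact continuous_of_dominated (bound := fun _ => B)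
      (fun q => (hH'.comp (Continuous.prodMk_right q)).aestronglyMeasurable)
      (fun q => ae_of_all _ fun x => hB _) (integrable_const _)
      (ae_of_all _ fun x => hH'.comp (Continuous.prodMk_left x))
  | succ k ih =>
    have hHS : ∀ S : Mat d, Measurable fun p : Trajectory d (k + 1) => H (S, p) := fun S =>
      (hH.comp (Continuous.prodMk_right S)).measurable
    simp_rw [fun S => integral_initial_succ hf.measurable h1 S k (hHS S) fun _ => hB _]
    exact ih (continuous_integral_transition hf hpos hH hB)
      fun q => abs_integral_transition_le hf.measurable q.1 _ fun _ => hB _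

/-- Properness of S ↦ S Sᵀ: an ultrafilter along which S Sᵀ converges lives on a compact set, hence
converges to some S with S Sᵀ = S₀ S₀ᵀ, where g has the value g S₀. -/
theorem tendsto_comap_mul_transpose {α : Type*} [TopologicalSpace α] {g : Mat d → α}
    (hg : Continuous g) {S₀ : Mat d} (h : ∀ S, S * Sᵀ = S₀ * S₀ᵀ → g S = g S₀) :
    Tendsto g (comap (fun S : Mat d => S * Sᵀ) (𝓝 (S₀ * S₀ᵀ))) (𝓝 (g S₀)) := by
  rw [tendsto_iff_ultrafilter]
  intro u hu
  have hu' : Tendsto (fun S : Mat d => S * Sᵀ) u (𝓝 (S₀ * S₀ᵀ)) := tendsto_iff_comap.2 hu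
  -- The diagonal controls the entries: |S i j| ≤ (S i j)² + 1 ≤ (S Sᵀ) i i + 1, and (S Sᵀ) i i is
  -- eventually below its limit plus 1.
  set R : Fin d → ℝ := fun i => (S₀ * S₀ᵀ) i i + 2
  set K : Set (Mat d) := Set.univ.pi fun i => Set.univ.pi fun _ => Set.Icc (-R i) (R i)
  have hK : IsCompact K := isCompact_univ_pi fun i => isCompact_univ_pi fun _ => isCompact_Icc
  have hKu : K ∈ (u : Filter (Mat d)) := by
    have hev : ∀ᶠ S in (u : Filter (Mat d)), ∀ i, (S * Sᵀ) i i < (S₀ * S₀ᵀ) i i + 1 := by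
      refine eventually_all.2 fun i => ?_
      have : Continuous fun A : Mat d => A i i := continuous_id.matrix_elem i i
      have hi : Tendsto (fun S : Mat d => (S * Sᵀ) i i) u (𝓝 ((S₀ * S₀ᵀ) i i)) :=
        (this.tendsto (S₀ * S₀ᵀ)).comp hu'
      exact hi.eventually (gt_mem_nhds (by linarith))
    filter_upwards [hev] with S hS
    refine Set.mem_univ_pi.2 fun i => Set.mem_univ_pi.2 fun j => abs_le.1 ?_
    have h1 : S i j ^ 2 ≤ (S * Sᵀ) i i := by
      rw [Matrix.mul_apply]
      simp_rw [Matrix.transpose_apply, ← sq]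
      exact Finset.single_le_sum (f := fun j => S i j ^ 2) (fun _ _ => sq_nonneg _)
        (Finset.mem_univ j)
    have h2 := hS i
    have h3 : |S i j| ≤ S i j ^ 2 + 1 := by
      rw [← sq_abs]
      nlinarith [sq_nonneg (|S i j| - 1), abs_nonneg (S i j)]
    simp only [R]
    linarith
  obtain ⟨S, -, hS⟩ := hK.ultrafilter_le_nhds' u hKu
  have hcont : Continuous fun S : Mat d => S * Sᵀ := continuous_id.matrix_mul
    continuous_id.matrix_transpose
  have := tendsto_nhds_unique (hcont.continuousAt.tendsto.mono_left hS) hu'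
  rw [← h S this]
  exact hg.continuousAt.tendsto.mono_left hS

theorem kernel_congr {f : Vec d → ℝ} (hf : Measurable f) {S T : Mat d} (h : S * Sᵀ = T * Tᵀ) :
    kernel f hf S = kernel f hf T := by
  ext1 x
  rw [kernel_apply, kernel_apply, transition, transition, proposal_congr h]

theorem chainLaw_congr {f : Vec d → ℝ} (hf : Measurable f) {S T : Mat d} (h : S * Sᵀ = T * Tᵀ) :
    chainLaw f hf S = chainLaw f hf T := by
  unfold chainLaw
  simp_rw [kernel_congr hf h]

/-! ### Weighted mean acceptance -/

/-- The stationary expectation of a weight `w ε` of the proposal noise `ε`, restricted to accepted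
proposals. -/
noncomputable def meanAccept (f : Vec d → ℝ) (S : Mat d) (w : Vec d → ℝ≥0∞) : ℝ≥0∞ :=
  ∫⁻ x, ∫⁻ ε, ENNReal.ofReal (f x * accept f x (x + Matrix.toEuclideanCLM (𝕜 := ℝ) S ε)) * w ε
    ∂(stdGaussian (Vec d))

theorem measurable_mul_accept {f : Vec d → ℝ} (hf : Measurable f) (S : Mat d) :
    Measurable fun q : Vec d × Vec d =>
      f q.1 * accept f q.1 (q.1 + Matrix.toEuclideanCLM (𝕜 := ℝ) S q.2) :=
  (hf.comp measurable_fst).mul ((measurable_accept_real hf).comp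
    (f := fun q : Vec d × Vec d => (q.1, q.1 + Matrix.toEuclideanCLM (𝕜 := ℝ) S q.2))
    (by fun_prop))

theorem ofReal_mul_accept_le {f : Vec d → ℝ} (hf0 : ∀ x, 0 ≤ f x) (x x' : Vec d) :
    ENNReal.ofReal (f x * accept f x x') ≤ ENNReal.ofReal (f x) :=
  ENNReal.ofReal_le_ofReal (mul_le_of_le_one_right (hf0 x) (accept_le_one _ _ _))

theorem meanAccept_le {f : Vec d → ℝ} (hf : Measurable f) (hf0 : ∀ x, 0 ≤ f x)
    (hf1 : ∫⁻ x, ENNReal.ofReal (f x) = 1) (S : Mat d) {w : Vec d → ℝ≥0∞} (hw : Measurable w) :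
    meanAccept f S w ≤ ∫⁻ ε, w ε ∂(stdGaussian (Vec d)) := by
  calc meanAccept f S w
      ≤ ∫⁻ x, ∫⁻ ε, ENNReal.ofReal (f x) * w ε ∂(stdGaussian (Vec d)) :=
        lintegral_mono fun x => lintegral_mono fun ε =>
          mul_le_mul_left (ofReal_mul_accept_le hf0 _ _) _
    _ = _ := by
        simp_rw [lintegral_const_mul _ hw]
        rw [lintegral_mul_const _ hf.ennreal_ofReal, hf1, one_mul]

theorem meanAccept_le_add {f g : Vec d → ℝ} (hf : Measurable f) (hf0 : ∀ x, 0 ≤ f x)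
    (hg : Measurable g) (hg0 : ∀ x, 0 ≤ g x) (S : Mat d) {w : Vec d → ℝ≥0∞} (hw : Measurable w) :
    meanAccept f S w
      ≤ meanAccept g S w + 2 * l1Dist f g * ∫⁻ ε, w ε ∂(stdGaussian (Vec d)) := by
  refine le_trans ?_ (add_le_add le_rfl
    (lintegral_enorm_mul_accept_sub_le hf hf0 hg hg0 S hw))
  have hm := (measurable_mul_accept hg S).ennreal_ofReal
  have hm2 : Measurable fun q : Vec d × Vec d => ENNReal.ofReal
      (g q.1 * accept g q.1 (q.1 + Matrix.toEuclideanCLM (𝕜 := ℝ) S q.2)) * w q.2 :=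
    hm.mul (hw.comp measurable_snd)
  rw [meanAccept, meanAccept, ← lintegral_add_left hm2.lintegral_prod_right']
  refine lintegral_mono fun x => ?_
  dsimp only
  have hx : Measurable fun ε => ENNReal.ofReal
      (g x * accept g x (x + Matrix.toEuclideanCLM (𝕜 := ℝ) S ε)) * w ε :=
    hm2.comp measurable_prodMk_left
  rw [← lintegral_add_left hx]
  refine lintegral_mono fun ε => ?_
  dsimp only
  rw [← add_mul]
  refine mul_le_mul_left ?_ _
  rw [Real.enorm_eq_ofReal_abs, ← ENNReal.ofReal_add
    (mul_nonneg (hg0 _) (accept_nonneg hg0 _ _)) (abs_nonneg _)]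
  refine ENNReal.ofReal_le_ofReal ?_
  linarith [le_abs_self (f x * accept f x (x + Matrix.toEuclideanCLM (𝕜 := ℝ) S ε)
    - g x * accept g x (x + Matrix.toEuclideanCLM (𝕜 := ℝ) S ε))]

theorem enorm_toReal_sub_toReal_le {a b c : ℝ≥0∞} (ha : a ≠ ∞) (hb : b ≠ ∞) (hab : a ≤ b + c)
    (hba : b ≤ a + c) : ‖a.toReal - b.toReal‖ₑ ≤ c := by
  rcases eq_or_ne c ∞ with rfl | hc
  · exact le_top
  rw [Real.enorm_eq_ofReal_abs]
  refine ENNReal.ofReal_le_of_le_toReal (abs_sub_le_iff.2 ⟨?_, ?_⟩)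
  · have := ENNReal.toReal_mono (ENNReal.add_ne_top.2 ⟨hb, hc⟩) hab
    rw [ENNReal.toReal_add hb hc] at this
    linarith
  · have := ENNReal.toReal_mono (ENNReal.add_ne_top.2 ⟨ha, hc⟩) hba
    rw [ENNReal.toReal_add ha hc] at this
    linarith

theorem l1Dist_comm (f g : Vec d → ℝ) : l1Dist f g = l1Dist g f := by
  unfold l1Dist
  simp_rw [enorm_sub_rev]

theorem enorm_meanAccept_toReal_sub_le {f g : Vec d → ℝ} (hf : Measurable f) (hf0 : ∀ x, 0 ≤ f x)
    (hf1 : ∫⁻ x, ENNReal.ofReal (f x) = 1) (hg : Measurable g) (hg0 : ∀ x, 0 ≤ g x)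
    (hg1 : ∫⁻ x, ENNReal.ofReal (g x) = 1) (S : Mat d) {w : Vec d → ℝ≥0∞} (hw : Measurable w)
    (hw1 : ∫⁻ ε, w ε ∂(stdGaussian (Vec d)) ≠ ∞) :
    ‖(meanAccept f S w).toReal - (meanAccept g S w).toReal‖ₑ
      ≤ 2 * (∫⁻ ε, w ε ∂(stdGaussian (Vec d))) * l1Dist f g := by
  rw [mul_right_comm]
  refine enorm_toReal_sub_toReal_le
    (ne_top_of_le_ne_top hw1 (meanAccept_le hf hf0 hf1 S hw))
    (ne_top_of_le_ne_top hw1 (meanAccept_le hg hg0 hg1 S hw))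
    (meanAccept_le_add hf hf0 hg hg0 S hw) ?_
  rw [l1Dist_comm]
  exact meanAccept_le_add hg hg0 hf hf0 S hw

/-- Dominated convergence on the product of Lebesgue and Gaussian measure; the dominating function
f(x) w(ε) does not depend on S. -/
theorem continuous_meanAccept {f : Vec d → ℝ} (hf : Continuous f) (hpos : ∀ x, 0 < f x)
    (h1 : ∫⁻ x, ENNReal.ofReal (f x) = 1) {w : Vec d → ℝ≥0∞} (hw : Measurable w)
    (hwt : ∀ ε, w ε ≠ ∞) (hw1 : ∫⁻ ε, w ε ∂(stdGaussian (Vec d)) ≠ ∞) :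
    Continuous fun S => meanAccept f S w := by
  have h0 : ∀ x, 0 ≤ f x := fun x => (hpos x).le
  have hm : ∀ S : Mat d, Measurable fun q : Vec d × Vec d => ENNReal.ofReal
      (f q.1 * accept f q.1 (q.1 + Matrix.toEuclideanCLM (𝕜 := ℝ) S q.2)) * w q.2 := fun S =>
    (measurable_mul_accept hf.measurable S).ennreal_ofReal.mul (hw.comp measurable_snd)
  have key : ∀ S : Mat d, meanAccept f S w = ∫⁻ q, ENNReal.ofReal
      (f q.1 * accept f q.1 (q.1 + Matrix.toEuclideanCLM (𝕜 := ℝ) S q.2)) * w q.2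
      ∂(volume.prod (stdGaussian (Vec d))) := fun S => by
    rw [lintegral_prod _ (hm S).aemeasurable, meanAccept]
  simp_rw [key]
  refine continuous_iff_continuousAt.2 fun S₀ => ?_
  refine tendsto_lintegral_filter_of_dominated_convergence
    (fun q => ENNReal.ofReal (f q.1) * w q.2) (Eventually.of_forall hm)
    (Eventually.of_forall fun S => ae_of_all _ fun q =>
      mul_le_mul_left (ofReal_mul_accept_le h0 _ _) _) ?_ (ae_of_all _ fun q => ?_)
  · rw [lintegral_prod_mul hf.measurable.ennreal_ofReal.aemeasurable hw.aemeasurable, h1, one_mul]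
    exact hw1
  · refine ENNReal.Tendsto.mul_const ?_ (Or.inr (hwt _))
    have hc : Continuous fun S : Mat d => ENNReal.ofReal
        (f q.1 * accept f q.1 (q.1 + Matrix.toEuclideanCLM (𝕜 := ℝ) S q.2)) := by
      refine ENNReal.continuous_ofReal.comp (continuous_const.mul ?_)
      exact (continuous_accept hf hpos).comp (continuous_const.prodMk (continuous_const.add
        (continuous_toEuclideanCLM_apply.comp (Continuous.prodMk_left q.2))))
    exact hc.continuousAt

theorem expectedAcceptance_eq {f : Vec d → ℝ} (hf : Measurable f) (hf0 : ∀ x, 0 ≤ f x)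
    (S : Mat d) :
    expectedAcceptance f (S * Sᵀ) = (meanAccept f S fun _ => 1).toReal := by
  have hm : Measurable fun q : Vec d × Vec d =>
      accept f q.1 (q.1 + Matrix.toEuclideanCLM (𝕜 := ℝ) S q.2) :=
    (measurable_accept_real hf).comp
      (f := fun q : Vec d × Vec d => (q.1, q.1 + Matrix.toEuclideanCLM (𝕜 := ℝ) S q.2))
      (by fun_prop)
  have hin : ∀ x, ∫ x', accept f x x' ∂(multivariateGaussian x (S * Sᵀ))
      = ∫ ε, accept f x (x + Matrix.toEuclideanCLM (𝕜 := ℝ) S ε) ∂(stdGaussian (Vec d)) := by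
    intro x
    have hx : Measurable fun x' => accept f x x' :=
      (measurable_accept_real hf).comp measurable_prodMk_left
    rw [← proposal_eq_multivariateGaussian, proposal, integral_map (by fun_prop)
      hx.aestronglyMeasurable]
  have hia : ∀ x, Integrable (fun ε => accept f x (x + Matrix.toEuclideanCLM (𝕜 := ℝ) S ε))
      (stdGaussian (Vec d)) := fun x =>
    Integrable.of_bound (measurable_accept_shift hf S x).aestronglyMeasurable 1
      (ae_of_all _ fun ε => by
        rw [Real.norm_of_nonneg (accept_nonneg hf0 _ _)]
        exact accept_le_one _ _ _)
  rw [expectedAcceptance]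
  simp_rw [hin]
  rw [integral_eq_lintegral_of_nonneg_ae
    (ae_of_all _ fun x => integral_nonneg fun ε => accept_nonneg hf0 _ _)
    hm.stronglyMeasurable.integral_prod_right'.aestronglyMeasurable]
  simp_rw [fun x => ofReal_integral_eq_lintegral_ofReal (hia x)
    (ae_of_all _ fun ε => accept_nonneg hf0 _ _)]
  rw [lintegral_densityMeasure hf hm.ennreal_ofReal.lintegral_prod_right', meanAccept]
  congr 1
  refine lintegral_congr fun x => ?_
  rw [← lintegral_const_mul _ (measurable_accept_shift hf S x).ennreal_ofReal]
  refine lintegral_congr fun ε => ?_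
  rw [mul_one, ENNReal.ofReal_mul (hf0 x)]

/-! ### Standardization of densities and chains -/

theorem lintegral_comp_smul_sub {s : ℝ} (hs : 0 < s) (c : Vec d) {h : Vec d → ℝ≥0∞}
    (hh : Measurable h) :
    ∫⁻ x, h (s • (x - c)) = ENNReal.ofReal ((s ^ d)⁻¹) * ∫⁻ z, h z := by
  rw [lintegral_sub_right_eq_self (fun x => h (s • x)), ← lintegral_map hh (measurable_const_smul s),
    Measure.map_addHaar_smul _ hs.ne', lintegral_smul_measure, finrank_euclideanSpace,
    Fintype.card_fin, abs_of_pos (by positivity)]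
  rfl

theorem measurable_standardizedDensity (n : ℕ) (c : Vec d) {f : Vec d → ℝ}
    (hf : Measurable f) : Measurable (standardizedDensity n c f) := by
  unfold standardizedDensity
  fun_prop

theorem standardizedDensity_nonneg (n : ℕ) (c : Vec d) {f : Vec d → ℝ} (hf0 : ∀ x, 0 ≤ f x)
    (x : Vec d) : 0 ≤ standardizedDensity n c f x :=
  div_nonneg (hf0 _) (by positivity)

section

variable {n : ℕ} (hn : 1 ≤ n) (c : Vec d) {f : Vec d → ℝ}

include hn

theorem sqrt_natCast_pos : 0 < Real.sqrt n := Real.sqrt_pos.2 (Nat.cast_pos.2 hn)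

theorem standardizedDensity_apply (x : Vec d) :
    standardizedDensity n c f (Real.sqrt n • (x - c)) = f x / Real.sqrt n ^ d := by
  have := sqrt_natCast_pos hn
  rw [standardizedDensity, smul_smul, inv_mul_cancel₀ this.ne', one_smul, add_sub_cancel]

theorem lintegral_standardizedDensity_mul (hf : Measurable f) {h : Vec d → ℝ≥0∞}
    (hh : Measurable h) :
    ∫⁻ z, ENNReal.ofReal (standardizedDensity n c f z) * h z
      = ∫⁻ x, ENNReal.ofReal (f x) * h (Real.sqrt n • (x - c)) := by
  have hs := sqrt_natCast_pos hn
  have hm := measurable_standardizedDensity n c hf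
  have key := lintegral_comp_smul_sub hs c (hm.ennreal_ofReal.mul hh)
  simp only [Pi.mul_apply, standardizedDensity_apply hn] at key
  have hpow : 0 < Real.sqrt n ^ d := by positivity
  simp_rw [div_eq_inv_mul, ENNReal.ofReal_mul (inv_nonneg.2 hpow.le), mul_assoc] at key
  rw [lintegral_const_mul _ (by fun_prop)] at key
  refine ((ENNReal.mul_right_inj ?_ ENNReal.ofReal_ne_top).1 key).symm
  simpa using hpow

theorem lintegral_standardizedDensity (hf : Measurable f) :
    ∫⁻ z, ENNReal.ofReal (standardizedDensity n c f z) = ∫⁻ x, ENNReal.ofReal (f x) := by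
  simpa using lintegral_standardizedDensity_mul hn c hf (h := fun _ => 1) measurable_const

theorem l1Dist_standardizedDensity {g : Vec d → ℝ} (hf : Measurable f) (hg : Measurable g) :
    l1Dist (standardizedDensity n c f) (standardizedDensity n c g) = l1Dist f g := by
  have hfg : Measurable fun x => |f x - g x| := (hf.sub hg).norm
  -- Standardization is linear and commutes with absolute values, so mass preservation for |f - g|
  -- is invariance of the distance.
  have := lintegral_standardizedDensity hn c hfg
  unfold l1Dist
  simp_rw [Real.enorm_eq_ofReal_abs]
  rw [← this]
  refine lintegral_congr fun x => ?_
  simp only [standardizedDensity]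
  rw [← sub_div, abs_div, abs_of_nonneg (a := Real.sqrt n ^ d) (by positivity)]

theorem standardizedDensity_gaussianDensity {C : Mat d} (hC : C.PosDef) :
    standardizedDensity n c (gaussianDensity c ((n : ℝ)⁻¹ • C)) = gaussianDensity 0 C := by
  have hs := sqrt_natCast_pos hn
  have hn0 : (0 : ℝ) < n := Nat.cast_pos.2 hn
  have hinv : ((n : ℝ)⁻¹ • C)⁻¹ = (n : ℝ) • C⁻¹ :=
    Matrix.inv_eq_left_inv (by
      rw [Matrix.smul_mul, Matrix.mul_smul, smul_smul, mul_inv_cancel₀ hn0.ne', one_smul,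
        Matrix.nonsing_inv_mul _ hC.det_pos.ne'.isUnit])
  funext z
  have hq : normSq ((n : ℝ)⁻¹ • C)⁻¹ ((Real.sqrt n)⁻¹ • z) = normSq C⁻¹ z := by
    rw [hinv, normSq, normSq, WithLp.ofLp_smul, Matrix.smul_mulVec, Matrix.mulVec_smul,
      smul_dotProduct, dotProduct_smul, dotProduct_smul, smul_eq_mul, smul_eq_mul, smul_eq_mul]
    have : (Real.sqrt n)⁻¹ * (n * (Real.sqrt n)⁻¹) = 1 := by
      nth_rw 2 [← Real.mul_self_sqrt hn0.le]
      field_simp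
    rw [← mul_assoc, ← mul_assoc, mul_assoc _ (n : ℝ), this, one_mul]
  have hdet : Real.sqrt ((2 * Real.pi) ^ d * ((n : ℝ)⁻¹ • C).det)
      = (Real.sqrt n ^ d)⁻¹ * Real.sqrt ((2 * Real.pi) ^ d * C.det) := by
    rw [Matrix.det_smul, Fintype.card_fin]
    have : (2 * Real.pi) ^ d * ((n : ℝ)⁻¹ ^ d * C.det)
        = ((Real.sqrt n ^ d)⁻¹) ^ 2 * ((2 * Real.pi) ^ d * C.det) := by
      rw [inv_pow, inv_pow, ← pow_mul, mul_comm d 2, pow_mul, Real.sq_sqrt hn0.le]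
      ring
    rw [this, Real.sqrt_mul (by positivity), Real.sqrt_sq (by positivity)]
  rw [standardizedDensity, gaussianDensity, gaussianDensity, add_sub_cancel_left, hq, hdet,
    mul_inv, inv_inv, sub_zero]
  field_simp

theorem accept_standardizedDensity (x x' : Vec d) :
    accept (standardizedDensity n c f) (Real.sqrt n • (x - c)) (Real.sqrt n • (x' - c))
      = accept f x x' := by
  have hs := sqrt_natCast_pos hn
  rw [accept, accept, standardizedDensity_apply hn, standardizedDensity_apply hn,
    div_div_div_cancel_right₀ (by positivity)]

/-- Affine equivariance of one RWM step: the proposals correspond, and the factor n^{d/2} cancels in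
the acceptance ratio. -/
theorem lintegral_transition_standardizedDensity (hf : Measurable f) (S : Mat d) (x : Vec d)
    {h : Vec d → ℝ≥0∞} (hh : Measurable h) :
    ∫⁻ z, h z ∂(transition (standardizedDensity n c f) (Real.sqrt n • S) (Real.sqrt n • (x - c)))
      = ∫⁻ x', h (Real.sqrt n • (x' - c)) ∂(transition f S x) := by
  have hmove : ∀ ε : Vec d, Real.sqrt n • (x - c)
      + Matrix.toEuclideanCLM (𝕜 := ℝ) (Real.sqrt n • S) ε
      = Real.sqrt n • (x + Matrix.toEuclideanCLM (𝕜 := ℝ) S ε - c) := fun ε => by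
    rw [map_smul, smul_apply, ← smul_add]
    congr 1
    abel
  rw [lintegral_transition (measurable_standardizedDensity n c hf) _ _ hh,
    lintegral_transition hf S x (g := fun x' => h (Real.sqrt n • (x' - c))) (by fun_prop)]
  simp_rw [hmove, accept_standardizedDensity hn]

theorem lintegral_initial_standardized (hf : Measurable f) (hf1 : ∫⁻ x, ENNReal.ofReal (f x) = 1)
    (S : Mat d) (k : ℕ) {H : Trajectory d k → ℝ≥0∞} (hH : Measurable H) :
    ∫⁻ θ, H (fun i => Real.sqrt n • (θ i - c)) ∂(chainLaw f hf S)
      = ∫⁻ z, H (initial k z) ∂(chainLaw (standardizedDensity n c f)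
          (measurable_standardizedDensity n c hf) (Real.sqrt n • S)) := by
  have hm := measurable_standardizedDensity n c hf
  have hg1 := (lintegral_standardizedDensity hn c hf).trans hf1
  induction k with
  | zero =>
    have hH' : Measurable fun x : Vec d => H fun _ => x := hH.comp (by fun_prop)
    have e1 : ∀ θ : ℕ → Vec d, H (fun i : Finset.Iic 0 => Real.sqrt n • (θ i - c))
        = H (fun _ => Real.sqrt n • (θ 0 - c)) := fun θ => by
      have := initial_zero fun k => Real.sqrt n • (θ k - c)
      exact congrArg H this
    simp_rw [e1, initial_zero]
    have e2 : ∀ {u : Vec d → ℝ} (hu : Measurable u) (T : Mat d) {h : Vec d → ℝ≥0∞},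
        Measurable h → ∫⁻ z, h (z 0) ∂(chainLaw u hu T) = ∫⁻ x, ENNReal.ofReal (u x) * h x :=
      fun hu T h hh => by
        rw [← lintegral_densityMeasure hu hh, ← map_eval_zero_chainLaw hu T,
          lintegral_map hh (measurable_pi_apply 0)]
    rw [e2 hm _ hH', e2 hf S (h := fun x => H fun _ => Real.sqrt n • (x - c))
      (hH'.comp (by fun_prop)), lintegral_standardizedDensity_mul hn c hf hH']
  | succ k ih =>
    have hHe : Measurable fun q : Trajectory d k × Vec d => H (q.1.extend q.2) :=
      hH.comp continuous_extend.measurable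
    have hT : Measurable fun p : Trajectory d k => ∫⁻ x', H (p.extend x')
        ∂(transition (standardizedDensity n c f) (Real.sqrt n • S) p.last) :=
      hHe.lintegral_kernel_prod_right'
        (κ := trajectoryKernel (standardizedDensity n c f) hm (Real.sqrt n • S) k)
    have e1 := ih hT
    simp_rw [initial_succ]
    rw [lintegral_chainLaw_succ hm _ hg1 k (G := fun q => H (q.1.extend q.2)) hHe]
    refine Eq.trans ?_ e1
    have hstd : Measurable fun q : Trajectory d k × Vec d =>
        H (Trajectory.extend (fun i => Real.sqrt n • (q.1 i - c)) (Real.sqrt n • (q.2 - c))) :=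
      hHe.comp (f := fun q : Trajectory d k × Vec d =>
        ((fun i => Real.sqrt n • (q.1 i - c) : Trajectory d k), Real.sqrt n • (q.2 - c))) (by fun_prop)
    have e2 := lintegral_chainLaw_succ hf S hf1 k hstd
    have e3 : ∀ θ : ℕ → Vec d, (fun i : Finset.Iic (k + 1) => Real.sqrt n • (θ i - c))
        = Trajectory.extend (fun i : Finset.Iic k => Real.sqrt n • (initial k θ i - c))
            (Real.sqrt n • (θ (k + 1) - c)) := fun θ =>
      initial_succ k fun j => Real.sqrt n • (θ j - c)
    simp_rw [e3]
    rw [e2]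
    refine lintegral_congr fun θ => ?_
    rw [← lintegral_transition_standardizedDensity hn c hf S (θ k)
      (h := fun x' => H (Trajectory.extend (fun i => Real.sqrt n • (initial k θ i - c)) x'))
      (hH.comp (measurable_extend _))]
    rfl

/-- Only initial segments are identified; weak convergence and jumps look at nothing else. -/
theorem map_initial_standardizedChainLaw (hf : Measurable f)
    (hf1 : ∫⁻ x, ENNReal.ofReal (f x) = 1) (S : Mat d) (k : ℕ) :
    (standardizedChainLaw n c f hf S).map (initial k)
      = (chainLaw (standardizedDensity n c f) (measurable_standardizedDensity n c hf)
          (Real.sqrt n • S)).map (initial k) := by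
  refine Measure.ext_of_lintegral _ fun H hH => ?_
  have hm : Measurable fun (θ : ℕ → Vec d) (k : ℕ) => Real.sqrt n • (θ k - c) := by fun_prop
  have hH' : Measurable fun z => H (initial k z) := hH.comp (measurable_initial k)
  rw [lintegral_map hH (measurable_initial k), lintegral_map hH (measurable_initial k),
    ← lintegral_initial_standardized hn c hf hf1 S k hH, standardizedChainLaw,
    lintegral_map hH' hm]
  rfl

end

/-! ### Squared jumping distances -/

/-- A rejected proposal contributes h(0) = 0, so only accepted moves Sε count, averaged over the
stationary law. -/
theorem lintegral_jump {f : Vec d → ℝ} (hf : Measurable f) (hf0 : ∀ x, 0 ≤ f x)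
    (hf1 : ∫⁻ x, ENNReal.ofReal (f x) = 1) (S : Mat d) (k : ℕ) {h : Vec d → ℝ≥0∞}
    (hh : Measurable h) (h0 : h 0 = 0) :
    ∫⁻ z, h (z (k + 1) - z k) ∂(chainLaw f hf S)
      = meanAccept f S fun ε => h (Matrix.toEuclideanCLM (𝕜 := ℝ) S ε) := by
  have hstep : ∀ x, ∫⁻ x', h (x' - x) ∂(transition f S x)
      = ∫⁻ ε, ENNReal.ofReal (accept f x (x + Matrix.toEuclideanCLM (𝕜 := ℝ) S ε))
          * h (Matrix.toEuclideanCLM (𝕜 := ℝ) S ε) ∂(stdGaussian (Vec d)) := fun x => by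
    rw [lintegral_transition hf S x (g := fun x' => h (x' - x)) (by fun_prop)]
    simp [h0]
  have hsucc := lintegral_chainLaw_succ hf S hf1 k (G := fun q => h (q.2 - q.1.last))
    (hh.comp (measurable_snd.sub (continuous_last.measurable.comp measurable_fst)))
  simp only [last_initial, hstep] at hsucc
  have hm : Measurable fun x => ∫⁻ ε,
      ENNReal.ofReal (accept f x (x + Matrix.toEuclideanCLM (𝕜 := ℝ) S ε))
        * h (Matrix.toEuclideanCLM (𝕜 := ℝ) S ε) ∂(stdGaussian (Vec d)) := by
    have h1 : Measurable fun q : Vec d × Vec d =>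
        ENNReal.ofReal (accept f q.1 (q.1 + Matrix.toEuclideanCLM (𝕜 := ℝ) S q.2)) :=
      (measurable_accept hf).comp
        (f := fun q : Vec d × Vec d => (q.1, q.1 + Matrix.toEuclideanCLM (𝕜 := ℝ) S q.2))
        (by fun_prop)
    have h2 : Measurable fun q : Vec d × Vec d => h (Matrix.toEuclideanCLM (𝕜 := ℝ) S q.2) := by
      fun_prop
    exact (h1.mul h2).lintegral_prod_right'
  rw [hsucc, lintegral_chainLaw_eval hf S hf0 hf1 k hm, meanAccept]
  refine lintegral_congr fun x => ?_
  have hx := (measurable_accept_shift hf S x).ennreal_ofReal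
  rw [← lintegral_const_mul _ (by fun_prop)]
  refine lintegral_congr fun ε => ?_
  rw [ENNReal.ofReal_mul (hf0 x), mul_assoc]

theorem measurable_jump (A : Mat d) (k : ℕ) :
    Measurable fun z : ℕ → Vec d => normSq A (z (k + 1) - z k) :=
  (measurable_normSq A).comp ((measurable_pi_apply _).sub (measurable_pi_apply _))

theorem normSq_eq_norm_inv_sq {A M : Mat d} (hA : IsUnit A.det) (h : M * Mᵀ = A⁻¹) (x : Vec d) :
    normSq A x = ‖Matrix.toEuclideanCLM (𝕜 := ℝ) M⁻¹ x‖ ^ 2 := by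
  rw [← normSq_transpose_mul_self, Matrix.transpose_nonsing_inv, ← Matrix.mul_inv_rev, h,
    Matrix.nonsing_inv_nonsing_inv _ hA]

theorem isUnit_det_of_mul_transpose_eq_inv {A M : Mat d} (hA : IsUnit A.det)
    (h : M * Mᵀ = A⁻¹) : IsUnit M.det := by
  have := (Matrix.isUnit_nonsing_inv_det_iff (A := A)).2 hA
  rw [← h, Matrix.det_mul] at this
  exact isUnit_of_mul_isUnit_left this

/-- The norm of A is the Euclidean norm after applying M⁻¹, which undoes the scaling of the noise;
the result no longer depends on A or M. -/
theorem normSq_smul_toEuclideanCLM {A M : Mat d} (hA : IsUnit A.det) (h : M * Mᵀ = A⁻¹) (lam : ℝ)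
    (ε : Vec d) :
    normSq A (Matrix.toEuclideanCLM (𝕜 := ℝ) (lam • M) ε) = lam ^ 2 * ‖ε‖ ^ 2 := by
  have hcomp : Matrix.toEuclideanCLM (𝕜 := ℝ) M⁻¹ (Matrix.toEuclideanCLM (𝕜 := ℝ) (lam • M) ε)
      = (Matrix.toEuclideanCLM (𝕜 := ℝ) M⁻¹ * Matrix.toEuclideanCLM (𝕜 := ℝ) (lam • M)) ε := rfl
  have hone : (1 : Vec d →L[ℝ] Vec d) ε = ε := rfl
  rw [normSq_eq_norm_inv_sq hA h, hcomp, ← map_mul, Matrix.mul_smul, Matrix.nonsing_inv_mul _ (isUnit_det_of_mul_transpose_eq_inv hA h), map_smul,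
    map_one, smul_apply, hone, norm_smul, mul_pow, Real.norm_eq_abs, sq_abs]

/-- The squared length of the scaled proposal noise. -/
noncomputable def noiseSq (lam : ℝ) (ε : Vec d) : ℝ≥0∞ := ENNReal.ofReal (lam ^ 2 * ‖ε‖ ^ 2)

theorem measurable_noiseSq (lam : ℝ) : Measurable (noiseSq lam : Vec d → ℝ≥0∞) := by
  unfold noiseSq
  fun_prop

theorem lintegral_noiseSq_ne_top (lam : ℝ) :
    ∫⁻ ε, noiseSq lam ε ∂(stdGaussian (Vec d)) ≠ ∞ := by
  have h2 : MemLp id 2 (stdGaussian (Vec d)) := IsGaussian.memLp_two_id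
  have hi : Integrable (fun ε : Vec d => lam ^ 2 * ‖ε‖ ^ 2) (stdGaussian (Vec d)) :=
    ((memLp_two_iff_integrable_sq_norm h2.1).1 h2).const_mul _
  have := (hasFiniteIntegral_iff_ofReal (ae_of_all _ fun ε => by positivity)).1 hi.2
  exact this.ne

section

variable {f : Vec d → ℝ} (hf : Measurable f) (hf0 : ∀ x, 0 ≤ f x)
    (hf1 : ∫⁻ x, ENNReal.ofReal (f x) = 1) {A M : Mat d} (h : M * Mᵀ = A⁻¹) (lam : ℝ)

include hf0 hf1 h

theorem lintegral_enorm_normSq_jump (k : ℕ) (hA : IsUnit A.det) :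
    ∫⁻ z, ‖normSq A (z (k + 1) - z k)‖ₑ ∂(chainLaw f hf (lam • M))
      = meanAccept f (lam • M) (noiseSq lam) := by
  rw [lintegral_jump hf hf0 hf1 (lam • M) k (h := fun x => ‖normSq A x‖ₑ)
    (measurable_normSq A).enorm (by simp [normSq])]
  congr 1 with ε
  rw [normSq_smul_toEuclideanCLM hA h, Real.enorm_of_nonneg (by positivity), noiseSq]

theorem lintegral_enorm_normSq_jump_of_not_isUnit (k : ℕ) (hA : ¬ IsUnit A.det) :
    ∫⁻ z, ‖normSq A (z (k + 1) - z k)‖ₑ ∂(chainLaw f hf (lam • M)) = 0 := by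
  -- The inverse of a singular matrix is 0 by convention, so M Mᵀ = 0 and the chain never moves.
  -- This case can occur because the information matrix is assumed nonsingular only at θ₀.
  have hM : M = 0 := by
    rw [Matrix.nonsing_inv_apply_not_isUnit _ hA] at h
    exact Matrix.self_mul_conjTranspose_eq_zero.1 (by simpa using h)
  rw [lintegral_jump hf hf0 hf1 (lam • M) k (h := fun x => ‖normSq A x‖ₑ)
    (measurable_normSq A).enorm (by simp [normSq]), hM]
  simp [meanAccept, normSq]

theorem lintegral_enorm_normSq_jump_ne_top (k : ℕ) :
    ∫⁻ z, ‖normSq A (z (k + 1) - z k)‖ₑ ∂(chainLaw f hf (lam • M)) ≠ ∞ := by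
  by_cases hA : IsUnit A.det
  · rw [lintegral_enorm_normSq_jump hf hf0 hf1 h lam k hA]
    exact ne_top_of_le_ne_top (lintegral_noiseSq_ne_top lam)
      (meanAccept_le hf hf0 hf1 _ (measurable_noiseSq lam))
  · rw [lintegral_enorm_normSq_jump_of_not_isUnit hf hf0 hf1 h lam k hA]
    exact ENNReal.zero_ne_top

theorem integrable_normSq_jump (k : ℕ) :
    Integrable (fun z => normSq A (z (k + 1) - z k)) (chainLaw f hf (lam • M)) :=
  ⟨(measurable_jump A k).aestronglyMeasurable,
    (lintegral_enorm_normSq_jump_ne_top hf hf0 hf1 h lam k).lt_top⟩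

theorem integral_normSq_jump (k : ℕ) :
    ∫ z, normSq A (z (k + 1) - z k) ∂(chainLaw f hf (lam • M))
      = if A.det = 0 then 0 else (meanAccept f (lam • M) (noiseSq lam)).toReal := by
  split_ifs with hA
  · have := enorm_integral_le_lintegral_enorm (μ := chainLaw f hf (lam • M))
      fun z : ℕ → Vec d => normSq A (z (k + 1) - z k)
    rw [lintegral_enorm_normSq_jump_of_not_isUnit hf hf0 hf1 h lam k (by simp [hA])] at this
    simpa using this
  · have hA : IsUnit A.det := isUnit_iff_ne_zero.2 hA
    have hnn : ∀ x, 0 ≤ normSq A x := fun x => by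
      rw [normSq_eq_norm_inv_sq hA h]
      positivity
    rw [integral_eq_lintegral_of_nonneg_ae (ae_of_all _ fun z => hnn _)
      (measurable_jump A k).aestronglyMeasurable,
      ← lintegral_enorm_normSq_jump hf hf0 hf1 h lam k hA]
    simp_rw [Real.enorm_of_nonneg (hnn _)]

end

/-- Both sides are the expected squared jump of the chain in the norm of (M Mᵀ)⁻¹, and the law of
the chain depends only on M Mᵀ. Time 0 stands for any time. -/
theorem meanAccept_noiseSq_congr {f : Vec d → ℝ} (hf : Measurable f) (hf0 : ∀ x, 0 ≤ f x)
    (hf1 : ∫⁻ x, ENNReal.ofReal (f x) = 1) {M N : Mat d} (hM : IsUnit (M * Mᵀ).det)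
    (h : N * Nᵀ = M * Mᵀ) (lam : ℝ) :
    meanAccept f (lam • N) (noiseSq lam) = meanAccept f (lam • M) (noiseSq lam) := by
  have hA := (Matrix.isUnit_nonsing_inv_det_iff (A := M * Mᵀ)).2 hM
  have hi := (Matrix.nonsing_inv_nonsing_inv _ hM).symm
  rw [← lintegral_enorm_normSq_jump hf hf0 hf1 hi lam 0 hA,
    ← lintegral_enorm_normSq_jump hf hf0 hf1 (h.trans hi) lam 0 hA]
  rw [chainLaw_congr hf (S := lam • N) (T := lam • M) (by simp [h])]

/-! ### Convergence in probability of the data-dependent quantities -/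

theorem edist_pi_lt {ι X : Type*} [Fintype ι] [PseudoEMetricSpace X] {f g : ι → X} {δ : ℝ≥0∞}
    (hδ : 0 < δ) (h : ∀ i, edist (f i) (g i) < δ) : edist f g < δ := by
  rw [edist_pi_def]
  exact (Finset.sup_lt_iff hδ).2 fun i _ => h i

section

variable {Ω : Type*} [MeasurableSpace Ω] {P : Measure Ω}
  {M : ℕ → Ω → Mat d} {M₀ : Mat d}

/-- Off a bad event of small probability the integrand is at most ε/2, and on it at most B. A union
bound over the finitely many entries controls the bad event. -/
theorem integralTendsto_comp [IsProbabilityMeasure P]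
    (hM : ∀ i j, TendstoInMeasure P (fun n y => (M n y * (M n y)ᵀ) i j) atTop
      (fun _ => (M₀ * M₀ᵀ) i j))
    {g : Mat d → ℝ} {a : ℝ}
    (hg : Tendsto g (comap (fun S : Mat d => S * Sᵀ) (𝓝 (M₀ * M₀ᵀ))) (𝓝 a))
    {B : ℝ} (hB : ∀ S, |g S - a| ≤ B) :
    IntegralTendsto P (fun n y => g (M n y)) a := by
  rw [IntegralTendsto, ENNReal.tendsto_nhds_zero]
  intro ε hε
  obtain ⟨r, hr0, hrε⟩ : ∃ r : ℝ, 0 < r ∧ ENNReal.ofReal r ≤ ε / 2 := by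
    obtain ⟨r, hr0, hr⟩ := ENNReal.lt_iff_exists_nnreal_btwn.1 (ENNReal.half_pos hε.ne')
    exact ⟨r, by exact_mod_cast hr0, by rw [ENNReal.ofReal_coe_nnreal]; exact hr.le⟩
  obtain ⟨U, hU, hUg⟩ := mem_comap.1 (hg (Metric.ball_mem_nhds a hr0))
  -- Matrices are viewed as functions with the supremum distance, matching entrywise convergence.
  obtain ⟨δ, hδ, hδU⟩ := (EMetric.mem_nhds_iff (α := Fin d → Fin d → ℝ)).1 hU
  set bad : ℕ → Set Ω := fun n => ⋃ i, ⋃ j,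
    {y | δ ≤ edist ((M n y * (M n y)ᵀ) i j) ((M₀ * M₀ᵀ) i j)} with hbad
  have hbad0 : Tendsto (fun n => ENNReal.ofReal B * P (bad n)) atTop (𝓝 0) := by
    have hsum : Tendsto (fun n => ∑ i, ∑ j,
        P {y | δ ≤ edist ((M n y * (M n y)ᵀ) i j) ((M₀ * M₀ᵀ) i j)}) atTop (𝓝 0) := by
      have := tendsto_finsetSum Finset.univ fun i _ => tendsto_finsetSum Finset.univ fun j _ =>
        hM i j δ hδ
      simpa using this
    have h0 : Tendsto (fun n => P (bad n)) atTop (𝓝 0) :=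
      tendsto_of_tendsto_of_tendsto_of_le_of_le tendsto_const_nhds hsum (fun _ => zero_le)
        fun n => (measure_iUnion_fintype_le _ _).trans
          (Finset.sum_le_sum fun i _ => measure_iUnion_fintype_le _ _)
    simpa using ENNReal.Tendsto.const_mul h0 (Or.inr ENNReal.ofReal_ne_top)
  filter_upwards [ENNReal.tendsto_nhds_zero.1 hbad0 (ε / 2) (ENNReal.half_pos hε.ne')] with n hn
  calc ∫⁻ y, ENNReal.ofReal |g (M n y) - a| ∂P
      ≤ ∫⁻ y, (ε / 2 + (bad n).indicator (fun _ => ENNReal.ofReal B) y) ∂P := by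
        refine lintegral_mono fun y => ?_
        by_cases hy : y ∈ bad n
        · simp only [hy, Set.indicator_of_mem]
          exact (ENNReal.ofReal_le_ofReal (hB _)).trans le_add_self
        · simp only [hy, not_false_eq_true, Set.indicator_of_notMem, add_zero]
          refine le_trans (ENNReal.ofReal_le_ofReal ?_) hrε
          have hmem : M n y * (M n y)ᵀ ∈ U := by
            refine hδU ?_
            simp only [hbad, Set.mem_iUnion, Set.mem_ofPred_eq, not_exists, not_le] at hy
            exact Metric.mem_eball.2 (edist_pi_lt hδ fun i => edist_pi_lt hδ fun j => hy i j)
          have : dist (g (M n y)) a < r := hUg hmem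
          exact (Real.dist_eq _ _ ▸ this).le
    _ = ε / 2 + ∫⁻ y, (bad n).indicator (fun _ => ENNReal.ofReal B) y ∂P := by
        rw [lintegral_add_left measurable_const]
        simp
    _ ≤ ε / 2 + ε / 2 :=
        add_le_add le_rfl ((lintegral_indicator_const_le _ _).trans hn)
    _ = ε := ENNReal.add_halves ε

theorem integralTendsto_of_enorm_sub_le {D : ℕ → Ω → ℝ≥0∞} (hD : ∀ n, Measurable (D n))
    (hD0 : Tendsto (fun n => ∫⁻ y, D n y ∂P) atTop (𝓝 0)) {C : ℝ≥0∞} (hC : C ≠ ∞)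
    {I J : ℕ → Ω → ℝ} {a : ℝ} (hJ : IntegralTendsto P J a)
    (h : ∀ n, 1 ≤ n → ∀ᵐ y ∂P, ‖I n y - J n y‖ₑ ≤ C * D n y) :
    IntegralTendsto P I a := by
  have hlim : Tendsto (fun n => C * (∫⁻ y, D n y ∂P)
      + ∫⁻ y, ENNReal.ofReal |J n y - a| ∂P) atTop (𝓝 0) := by
    simpa using (ENNReal.Tendsto.const_mul hD0 (Or.inr hC)).add hJ
  refine tendsto_of_tendsto_of_tendsto_of_le_of_le' tendsto_const_nhds hlim
    (Eventually.of_forall fun _ => zero_le) ?_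
  filter_upwards [eventually_ge_atTop 1] with n hn
  rw [← lintegral_const_mul _ (hD n), ← lintegral_add_left ((hD n).const_mul C)]
  refine lintegral_mono_ae ?_
  filter_upwards [h n hn] with y hy
  rw [← Real.enorm_eq_ofReal_abs, ← Real.enorm_eq_ofReal_abs, ← sub_add_sub_cancel _ (J n y)]
  exact (enorm_add_le _ _).trans (add_le_add hy le_rfl)

end

/-! ### The Gaussian target as the scaling varies -/

theorem smul_mul_transpose_smul (lam : ℝ) (M : Mat d) :
    (lam • M) * (lam • M)ᵀ = lam ^ 2 • (M * Mᵀ) := by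
  rw [Matrix.transpose_smul, Matrix.smul_mul, Matrix.mul_smul, smul_smul, sq]

theorem measurable_gaussianDensity_comp {Ω : Type*} [MeasurableSpace Ω] {c : Ω → Vec d}
    (hc : Measurable c) (C : Mat d) :
    Measurable fun q : Ω × Vec d => gaussianDensity (c q.1) C q.2 := by
  have h : Measurable fun q : Ω × Vec d => normSq C⁻¹ (q.2 - c q.1) :=
    (measurable_normSq C⁻¹).comp (by fun_prop)
  unfold gaussianDensity
  fun_prop

theorem integral_initial_eq {f : Vec d → ℝ} (hf : Measurable f) {S : Mat d} {k : ℕ}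
    {L : Measure (ℕ → Vec d)} (hL : L.map (initial k) = (chainLaw f hf S).map (initial k))
    {H : Trajectory d k → ℝ} (hH : Measurable H) :
    ∫ z, H (initial k z) ∂L = ∫ z, H (initial k z) ∂(chainLaw f hf S) := by
  rw [← integral_map (measurable_initial k).aemeasurable hH.aestronglyMeasurable, hL,
    integral_map (measurable_initial k).aemeasurable hH.aestronglyMeasurable]

theorem integrable_initial_iff {f : Vec d → ℝ} (hf : Measurable f) {S : Mat d} {k : ℕ}
    {L : Measure (ℕ → Vec d)} (hL : L.map (initial k) = (chainLaw f hf S).map (initial k))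
    {H : Trajectory d k → ℝ} (hH : Measurable H) :
    Integrable (fun z => H (initial k z)) L
      ↔ Integrable (fun z => H (initial k z)) (chainLaw f hf S) := by
  have h : ∀ ν : Measure (ℕ → Vec d),
      Integrable H (ν.map (initial k)) ↔ Integrable (fun z => H (initial k z)) ν := fun ν =>
    integrable_map_measure hH.aestronglyMeasurable (measurable_initial k).aemeasurable
  rw [← h, hL, h]

section

variable {C : Mat d} (hC : C.PosDef) (lam : ℝ)

include hC

theorem tendsto_integral_gaussian_chainLaw (M₀ : Mat d) (k : ℕ) {H : Trajectory d k → ℝ}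
    (hH : Continuous H) {B : ℝ} (hB : ∀ p, |H p| ≤ B) :
    Tendsto (fun M : Mat d => ∫ z, H (initial k z)
        ∂(chainLaw (gaussianDensity 0 C) (measurable_gaussianDensity 0 C) (lam • M)))
      (comap (fun M : Mat d => M * Mᵀ) (𝓝 (M₀ * M₀ᵀ)))
      (𝓝 (∫ z, H (initial k z)
        ∂(chainLaw (gaussianDensity 0 C) (measurable_gaussianDensity 0 C) (lam • M₀)))) := by
  have hc := continuous_integral_chainLaw (continuous_gaussianDensity 0 C)
    (gaussianDensity_pos 0 hC) (lintegral_gaussianDensity 0 hC) k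
    (H := fun q => H q.2) (hH.comp continuous_snd) fun q => hB q.2
  refine tendsto_comap_mul_transpose
    (hc.comp (g := fun S : Mat d => ∫ z, H (initial k z)
      ∂(chainLaw (gaussianDensity 0 C) (measurable_gaussianDensity 0 C) S))
      (continuous_const_smul lam)) fun M h => ?_
  simp only [Function.comp_apply]
  rw [chainLaw_congr _ (S := lam • M) (T := lam • M₀) (by
    rw [smul_mul_transpose_smul, smul_mul_transpose_smul, h])]

/-- For a general weight the mean can depend on M beyond M Mᵀ, since rotating the noise changes
w(ε); `hcongr` excludes this. -/
theorem tendsto_meanAccept_gaussian {M₀ : Mat d} {w : Vec d → ℝ≥0∞} (hw : Measurable w)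
    (hwt : ∀ ε, w ε ≠ ∞) (hw1 : ∫⁻ ε, w ε ∂(stdGaussian (Vec d)) ≠ ∞)
    (hcongr : ∀ M : Mat d, M * Mᵀ = M₀ * M₀ᵀ → (meanAccept (gaussianDensity 0 C) (lam • M) w).toReal
      = (meanAccept (gaussianDensity 0 C) (lam • M₀) w).toReal) :
    Tendsto (fun M : Mat d => (meanAccept (gaussianDensity 0 C) (lam • M) w).toReal)
      (comap (fun M : Mat d => M * Mᵀ) (𝓝 (M₀ * M₀ᵀ)))
      (𝓝 (meanAccept (gaussianDensity 0 C) (lam • M₀) w).toReal) := by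
  have hc := continuous_meanAccept (continuous_gaussianDensity 0 C)
    (gaussianDensity_pos 0 hC) (lintegral_gaussianDensity 0 hC) hw hwt hw1
  refine tendsto_comap_mul_transpose (g := fun M : Mat d =>
    (meanAccept (gaussianDensity 0 C) (lam • M) w).toReal) ?_ hcongr
  refine continuous_iff_continuousAt.2 fun M => ?_
  refine (ENNReal.tendsto_toReal ?_).comp (hc.comp (continuous_const_smul lam)).continuousAt
  exact ne_top_of_le_ne_top hw1 (meanAccept_le (measurable_gaussianDensity 0 C)
    (gaussianDensity_nonneg 0 C) (lintegral_gaussianDensity 0 hC) _ hw)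

theorem abs_toReal_meanAccept_gaussian_le (M : Mat d) {w : Vec d → ℝ≥0∞} (hw : Measurable w)
    (hw1 : ∫⁻ ε, w ε ∂(stdGaussian (Vec d)) ≠ ∞) :
    |(meanAccept (gaussianDensity 0 C) M w).toReal|
      ≤ (∫⁻ ε, w ε ∂(stdGaussian (Vec d))).toReal := by
  rw [abs_of_nonneg ENNReal.toReal_nonneg]
  exact ENNReal.toReal_mono hw1 (meanAccept_le (measurable_gaussianDensity 0 C)
    (gaussianDensity_nonneg 0 C) (lintegral_gaussianDensity 0 hC) _ hw)

end

theorem abs_sub_le_two_mul {a b B : ℝ} (ha : |a| ≤ B) (hb : |b| ≤ B) : |a - b| ≤ 2 * B := by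
  have := abs_sub a b
  linarith

end RWM

/-! ### The theorem -/

set_option maxHeartbeats 400000 in
open RWM in
theorem theorem1 {d : ℕ} {Y : ℕ → Type*} [∀ i, MeasurableSpace (Y i)]
    -- the data-generating process
    (PY : Measure (∀ i, Y i)) [IsProbabilityMeasure PY]
    -- the (data-dependent) target densities on `ℝ^d`
    (post : ℕ → (∀ i, Y i) → RWM.Vec d → ℝ)
    (hpost_meas : ∀ n, Measurable (Function.uncurry (post n)))
    (hpost_nonneg : ∀ n y θ, 0 ≤ post n y θ)
    (hpost_one : ∀ n, 1 ≤ n → ∀ᵐ y ∂PY, ∫⁻ θ, ENNReal.ofReal (post n y θ) = 1)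
    -- the Fisher information, the true parameter value and the estimators
    (fisher : RWM.Vec d → RWM.Mat d) (θ₀ : RWM.Vec d) (hfisher : (fisher θ₀).PosDef)
    (est : ℕ → (∀ i, Y i) → RWM.Vec d) (hest_meas : ∀ n, Measurable (est n))
    -- the Bernstein–von Mises approximation
    (hBvM : RWM.IntegralTendsto PY (fun n y => ∫ θ, |post n y θ -
      RWM.gaussianDensity (est n y) ((n : ℝ)⁻¹ • (fisher θ₀)⁻¹) θ|) 0)
    (hest : TendstoInMeasure PY est atTop (fun _ => θ₀))
    -- the proposal scaling `S_n = (lam / √n) M_n`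
    (lam : ℝ) (hlam : 0 < lam)
    (Mn : ℕ → (∀ i, Y i) → RWM.Mat d) (hMn_meas : ∀ n i j, Measurable (fun y => Mn n y i j))
    (M : RWM.Mat d)
    (hMn : ∀ i j, TendstoInMeasure PY (fun n y => (Mn n y * (Mn n y)ᵀ) i j) atTop
      (fun _ => (M * Mᵀ) i j))
    -- the laws of the standardized stationary chains and of the stationary limiting chain
    (Ξn : ℕ → (∀ i, Y i) → Measure (ℕ → RWM.Vec d))
    (hΞn : ∀ n y, Ξn n y = RWM.standardizedChainLaw n (est n y) (post n y)
      ((hpost_meas n).of_uncurry_left) ((lam / Real.sqrt n) • Mn n y))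
    (Ξ : Measure (ℕ → RWM.Vec d))
    (hΞ : Ξ = RWM.chainLaw (RWM.gaussianDensity 0 (fisher θ₀)⁻¹)
      (RWM.measurable_gaussianDensity 0 (fisher θ₀)⁻¹) (lam • M)) :
    -- weak convergence of the chains
    RWM.WeaklyTendsto PY Ξn Ξ ∧
    -- convergence of the expected acceptance probabilities
    RWM.IntegralTendsto PY
      (fun n y => RWM.expectedAcceptance (RWM.standardizedDensity n (est n y) (post n y))
        (lam ^ 2 • (Mn n y * (Mn n y)ᵀ)))
      (RWM.expectedAcceptance (RWM.gaussianDensity 0 (fisher θ₀)⁻¹) (lam ^ 2 • (M * Mᵀ))) ∧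
    -- convergence of the expected squared jumping distances
    ((∀ n, 1 ≤ n → ∀ᵐ y ∂PY, Mn n y * (Mn n y)ᵀ = (fisher (est n y))⁻¹) →
      M * Mᵀ = (fisher θ₀)⁻¹ →
      ∀ k : ℕ,
        (∀ n, 1 ≤ n → ∀ᵐ y ∂PY,
          Integrable (fun z => RWM.normSq (fisher (est n y)) (z (k + 1) - z k)) (Ξn n y)) ∧
        Integrable (fun z => RWM.normSq (fisher θ₀) (z (k + 1) - z k)) Ξ ∧
        RWM.IntegralTendsto PY
          (fun n y => ∫ z, RWM.normSq (fisher (est n y)) (z (k + 1) - z k) ∂(Ξn n y))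
          (∫ z, RWM.normSq (fisher θ₀) (z (k + 1) - z k) ∂Ξ)) := by
  set C : Mat d := (fisher θ₀)⁻¹ with hCdef
  have hC : C.PosDef := hfisher.inv
  have hφ : Measurable (gaussianDensity 0 C) := measurable_gaussianDensity 0 C
  have hφ0 : ∀ x, 0 ≤ gaussianDensity 0 C x := gaussianDensity_nonneg 0 C
  have hφ1 := lintegral_gaussianDensity 0 hC
  have hpm : ∀ n y, Measurable (post n y) := fun n y => (hpost_meas n).of_uncurry_left
  -- the `L¹`-distance in the Bernstein–von Mises approximation
  set D : ℕ → (∀ i, Y i) → ℝ≥0∞ := fun n y =>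
    l1Dist (post n y) (gaussianDensity (est n y) ((n : ℝ)⁻¹ • C)) with hD
  have hDm : ∀ n, Measurable (D n) := fun n =>
    ((hpost_meas n).sub (measurable_gaussianDensity_comp (hest_meas n) _)).enorm.lintegral_prod_right'
  -- Both densities are integrable for n ≥ 1, so the real integral in `hBvM` is the extended one. At
  -- n = 0 the covariance degenerates, and finitely many n do not matter.
  have hD0 : Tendsto (fun n => ∫⁻ y, D n y ∂PY) atTop (𝓝 0) := by
    refine Tendsto.congr' ?_ hBvM
    filter_upwards [eventually_ge_atTop 1] with n hn
    refine lintegral_congr_ae ?_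
    filter_upwards [hpost_one n hn] with y hy
    have hCn : ((n : ℝ)⁻¹ • C).PosDef := hC.smul (by positivity)
    have hi : Integrable fun θ => post n y θ - gaussianDensity (est n y) ((n : ℝ)⁻¹ • C) θ :=
      (integrable_of_lintegral_eq_one (hpm n y) (hpost_nonneg n y) hy).sub
        (integrable_of_lintegral_eq_one (measurable_gaussianDensity _ _)
          (gaussianDensity_nonneg _ _) (lintegral_gaussianDensity _ hCn))
    rw [sub_zero, abs_of_nonneg (integral_nonneg fun _ => abs_nonneg _),
      ofReal_integral_eq_lintegral_ofReal hi.abs (ae_of_all _ fun _ => abs_nonneg _)]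
    simp only [hD, l1Dist, Real.enorm_eq_ofReal_abs]
  -- the standardized densities
  have hsm : ∀ n y, Measurable (standardizedDensity n (est n y) (post n y)) := fun n y =>
    measurable_standardizedDensity _ _ (hpm n y)
  have hs0 : ∀ n y z, 0 ≤ standardizedDensity n (est n y) (post n y) z := fun n y =>
    standardizedDensity_nonneg _ _ (hpost_nonneg n y)
  have hs1 : ∀ n, 1 ≤ n → ∀ᵐ y ∂PY,
      ∫⁻ z, ENNReal.ofReal (standardizedDensity n (est n y) (post n y) z) = 1 := fun n hn => by
    filter_upwards [hpost_one n hn] with y hy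
    rw [lintegral_standardizedDensity hn _ (hpm n y), hy]
  have hsD : ∀ n, 1 ≤ n → ∀ y,
      l1Dist (standardizedDensity n (est n y) (post n y)) (gaussianDensity 0 C) = D n y :=
    fun n hn y => by
      rw [← standardizedDensity_gaussianDensity hn (est n y) hC,
        l1Dist_standardizedDensity hn _ (hpm n y) (measurable_gaussianDensity _ _)]
  have hlaw : ∀ n, 1 ≤ n → ∀ᵐ y ∂PY, ∀ k, (Ξn n y).map (initial k)
      = (chainLaw _ (hsm n y) (lam • Mn n y)).map (initial k) := fun n hn => by
    filter_upwards [hpost_one n hn] with y hy k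
    have hs := sqrt_natCast_pos hn
    have hS : Real.sqrt n • (lam / Real.sqrt n) • Mn n y = lam • Mn n y := by
      rw [smul_smul, mul_div_cancel₀ _ hs.ne']
    rw [hΞn, map_initial_standardizedChainLaw hn _ (hpm n y) hy, hS]
  refine ⟨fun k h => ?_, ?_, fun hMinv hM k => ?_⟩
  · set H : Trajectory d k → ℝ := fun p =>
      h fun i => p ⟨i, Finset.mem_Iic.2 (Nat.le_of_lt_succ i.2)⟩ with hH
    have hHc : Continuous H := h.continuous.comp (by fun_prop)
    have hHB : ∀ p, |H p| ≤ ‖h‖ := fun p => h.norm_coe_le_norm _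
    have hbound : ∀ M : Mat d,
        |∫ z, H (initial k z) ∂(chainLaw (gaussianDensity 0 C) hφ (lam • M))| ≤ ‖h‖ := fun M => by
      have := isProbabilityMeasure_chainLaw hφ (lam • M) hφ1
      have := norm_integral_le_of_norm_le_const
        (μ := chainLaw (gaussianDensity 0 C) hφ (lam • M)) (f := fun z => H (initial k z))
        (C := ‖h‖) (ae_of_all _ fun z => hHB _)
      simpa using this
    -- The intermediate quantity has the Gaussian target and the data-dependent scaling λ M_n; it is
    -- then compared with the true chain at the same scaling.
    have hlim := integralTendsto_comp (P := PY) hMn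
      (tendsto_integral_gaussian_chainLaw hC lam M k hHc hHB)
      fun S => abs_sub_le_two_mul (hbound S) (hbound M)
    rw [hΞ]
    refine integralTendsto_of_enorm_sub_le hDm hD0 (C := ENNReal.ofReal ‖h‖ * (1 + 6 * k))
      (ENNReal.mul_ne_top ENNReal.ofReal_ne_top (by finiteness)) hlim fun n hn => ?_
    filter_upwards [hlaw n hn, hs1 n hn] with y hy hy1
    rw [← hsD n hn y]
    have e := integral_initial_eq (hsm n y) (hy k) hHc.measurable
    have := enorm_integral_chainLaw_sub_le (hsm n y) (hs0 n y) hy1 hφ hφ0 hφ1 (lam • Mn n y) k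
      hHc.measurable hHB
    rw [← e] at this
    exact this
  · have hw1 : ∫⁻ _ : Vec d, 1 ∂(stdGaussian (Vec d)) ≠ ∞ := by simp
    have heq : ∀ {f : Vec d → ℝ}, Measurable f → (∀ x, 0 ≤ f x) → ∀ N : Mat d,
        expectedAcceptance f (lam ^ 2 • (N * Nᵀ)) = (meanAccept f (lam • N) fun _ => 1).toReal :=
      fun hf hf0 N => by
        rw [← expectedAcceptance_eq hf hf0, smul_mul_transpose_smul]
    have hlim := integralTendsto_comp (P := PY) hMn
      (tendsto_meanAccept_gaussian hC lam (M₀ := M) (w := fun _ => 1) measurable_const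
        (fun _ => ENNReal.one_ne_top) hw1 fun N hN => by rw [← heq hφ hφ0, ← heq hφ hφ0, hN])
      fun S => abs_sub_le_two_mul
        (abs_toReal_meanAccept_gaussian_le hC _ measurable_const hw1)
        (abs_toReal_meanAccept_gaussian_le hC _ measurable_const hw1)
    rw [heq hφ hφ0]
    refine integralTendsto_of_enorm_sub_le hDm hD0 (ENNReal.mul_ne_top (ENNReal.ofNat_ne_top (n := 2)) hw1)
      hlim fun n hn => ?_
    filter_upwards [hs1 n hn] with y hy1
    rw [← hsD n hn y, heq (hsm n y) (hs0 n y)]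
    exact enorm_meanAccept_toReal_sub_le (hsm n y) (hs0 n y) hy1 hφ hφ0 hφ1 _ measurable_const hw1
  · have hw1 := lintegral_noiseSq_ne_top (d := d) lam
    have hwm := measurable_noiseSq (d := d) lam
    have hdet0 : (fisher θ₀).det ≠ 0 := hfisher.det_pos.ne'
    have hdetM : (M * Mᵀ).det ≠ 0 := by
      rw [hM]
      exact hC.det_pos.ne'
    -- The jump at time k is a function of the path up to time k + 1, so `hlaw` at k + 1 transfers
    -- it to the RWM chain.
    have hJm : ∀ A : Mat d, Measurable fun p : Trajectory d (k + 1) =>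
        normSq A (p.last - p ⟨k, Finset.mem_Iic.2 (Nat.le_succ k)⟩) := fun A =>
      (measurable_normSq A).comp (continuous_last.measurable.sub (measurable_pi_apply _))
    refine ⟨fun n hn => ?_, ?_, ?_⟩
    · filter_upwards [hlaw n hn, hs1 n hn, hMinv n hn] with y hy hy1 hyM
      exact (integrable_initial_iff (hsm n y) (hy (k + 1)) (hJm _)).2
        (integrable_normSq_jump (hsm n y) (hs0 n y) hy1 hyM lam k)
    · rw [hΞ]
      exact integrable_normSq_jump hφ hφ0 hφ1 hM lam k
    -- The zero branch reproduces the jump of a chain that never moves when the estimated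
    -- information is singular. Near M Mᵀ, whose determinant is nonzero, it is inactive and does not
    -- affect the limit.
    · set g : Mat d → ℝ := fun N => if (N * Nᵀ).det = 0 then 0 else
        (meanAccept (gaussianDensity 0 C) (lam • N) (noiseSq lam)).toReal with hg
      set W : ℝ := (∫⁻ ε, noiseSq lam ε ∂(stdGaussian (Vec d))).toReal with hW
      have hgB : ∀ N, |g N| ≤ W := fun N => by
        simp only [hg]
        split_ifs
        · simp [hW]
        · exact abs_toReal_meanAccept_gaussian_le hC _ hwm hw1
      have hgt : Tendsto g (comap (fun N : Mat d => N * Nᵀ) (𝓝 (M * Mᵀ))) (𝓝 (g M)) := by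
        have hgM : g M
            = (meanAccept (gaussianDensity 0 C) (lam • M) (noiseSq lam)).toReal := if_neg hdetM
        rw [hgM]
        refine Tendsto.congr' ?_ (tendsto_meanAccept_gaussian hC lam hwm
          (fun _ => ENNReal.ofReal_ne_top) hw1 fun N hN => by
            rw [meanAccept_noiseSq_congr hφ hφ0 hφ1 hdetM.isUnit hN])
        have hev : ∀ᶠ N : Mat d in comap (fun N : Mat d => N * Nᵀ) (𝓝 (M * Mᵀ)),
            (N * Nᵀ).det ≠ 0 :=
          ((continuous_id.matrix_det.tendsto (M * Mᵀ)).comp tendsto_comap).eventually_ne hdetM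
        filter_upwards [hev] with N hN
        exact (if_neg hN).symm
      have hlim := integralTendsto_comp (P := PY) hMn hgt
        fun S => abs_sub_le_two_mul (hgB S) (hgB M)
      have hgM : ∫ z, normSq (fisher θ₀) (z (k + 1) - z k) ∂Ξ = g M := by
        rw [hΞ]
        refine (integral_normSq_jump hφ hφ0 hφ1 hM lam k).trans ?_
        rw [if_neg hdet0]
        exact (if_neg hdetM).symm
      rw [hgM]
      refine integralTendsto_of_enorm_sub_le hDm hD0
        (ENNReal.mul_ne_top (ENNReal.ofNat_ne_top (n := 2)) hw1) hlim fun n hn => ?_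
      filter_upwards [hlaw n hn, hs1 n hn, hMinv n hn] with y hy hy1 hyM
      have e1 : ∫ z, normSq (fisher (est n y)) (z (k + 1) - z k) ∂(Ξn n y)
          = if (fisher (est n y)).det = 0 then 0 else
            (meanAccept _ (lam • Mn n y) (noiseSq lam)).toReal :=
        (integral_initial_eq (hsm n y) (hy (k + 1)) (hJm _)).trans
          (integral_normSq_jump (hsm n y) (hs0 n y) hy1 hyM lam k)
      -- Also for a singular matrix, the determinant of the conventional inverse is the conventional
      -- inverse of the determinant. So the true jump and g at M_n switch to zero on the same event.
      have e2 : (Mn n y * (Mn n y)ᵀ).det = 0 ↔ (fisher (est n y)).det = 0 := by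
        rw [hyM, Matrix.det_nonsing_inv, Ring.inverse_eq_inv', inv_eq_zero]
      rw [e1]
      simp only [hg, e2]
      split_ifs
      · simp
      · rw [← hsD n hn y]
        exact enorm_meanAccept_toReal_sub_le (hsm n y) (hs0 n y) hy1 hφ hφ0 hφ1 _ hwm hw1
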